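/- Let $\mathbb R^3_1$ be $\mathbb R^3$ with the scalar product $\langle x,y\rangle=x_1y_1+x_2y_2-x_3y_3$ and the standard orientation. For a $C^2$ time-like surface $z=z(u,v)$ in $\mathbb R^3_1$ with $E=\langle z_u,z_u\rangle<0$ and $G=\langle z_v,z_v\rangle>0$ put $F=\langle z_u,z_v\rangle$, $X=z_u/\sqrt{-E}$, $Y=z_v/\sqrt G$, let $l$ be the unit normal field ($\langle l,l\rangle=1$) for which $XYl$ is positively oriented, and let $L=\langle l,z_{uu}\rangle$, $M=\langle l,z_{uv}\rangle$, $N=\langle l,z_{vv}\rangle$. The parameters are principal if $F=M=0$; then the invariants of the surface are $$\nu_1=\frac LE,\qquad \nu_2=\frac NG,\qquad \gamma_1=\frac{E_v}{2E\sqrt G},\qquad \gamma_2=\frac{-G_u}{2G\sqrt{-E}} .$$ A surface in principal parameters is strongly regular if $(\nu_1-\nu_2)\gamma_1\gamma_2\neq0$ everywhere. **Theorem.** Let $1\le n\le\infty$, let $\mathcal D\subset\mathbb R^2$ be an open neighborhood of $(u_0,v_0)$, and let $\nu_1,\nu_2\in C^{n+1}(\mathcal D)$ and $\gamma_1,\gamma_2\in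 C^{n}(\mathcal D)$ be real functions satisfying on $\mathcal D$ 1) $(\nu_1-\nu_2)\,\gamma_1\,(\nu_1)_v<0,\qquad (\nu_1-\nu_2)\,\gamma_2\,(\nu_2)_u<0,$ 2.1) $\displaystyle\left(\ln\left|\frac{(\nu_1)_v}{\gamma_1}\right|\right)_u=\frac{(\nu_1)_u}{\nu_1-\nu_2},\qquad \left(\ln\left|\frac{(\nu_2)_u}{\gamma_2}\right|\right)_v=-\frac{(\nu_2)_v}{\nu_1-\nu_2},$ 2.2) $\displaystyle\frac{\nu_1-\nu_2}{2}\left(\frac{(\gamma_2^2)_u}{(\nu_2)_u}+\frac{(\gamma_1^2)_v}{(\nu_1)_v}\right)-(\gamma_1^2-\gamma_2^2)=\nu_1\nu_2 .$ Let $z_0\in\mathbb R^3_1$ and let $X_0,Y_0,l_0$ be a positively oriented orthonormal frame with $\langle X_0,X_0\rangle=-1$, $\langle Y_0,Y_0\rangle=\langle l_0,l_0\rangle=1$. Then there are a connected open set $\mathcal D_0\subset\mathcal D$ containing $(u_0,v_0)$ and a strongly regular time-like surface $z=z(u,v)$, $(u,v)\in\mathcal D_0$, of class $C^{n+1}$,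 in principal parameters, whose invariants are the given functions $\nu_1,\nu_2,\gamma_1,\gamma_2$ and for which $$z(u_0,v_0)=z_0,\quad X(u_0,v_0)=X_0,\quad Y(u_0,v_0)=Y_0,\quad l(u_0,v_0)=l_0 .$$ This surface is unique: on every connected open set $\mathcal D_1\subset\mathcal D$ containing $(u_0,v_0)$, any two strongly regular time-like surfaces of class $C^2$, in principal parameters, with these invariants and these initial values coincide. -/

import Mathlib

noncomputable section

namespace TimelikeSurface

/-- The scalar product of Minkowski space `ℝ³₁` (signature `(2,1)`): `e₁² = e₂² = 1`, `e₃² = -1`. -/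
def mink (x y : Fin 3 → ℝ) : ℝ := x 0 * y 0 + x 1 * y 1 - x 2 * y 2

/-- The determinant of three vectors; `e₁, e₂, e₃` gives the orientation of the space. -/
def vol (x y w : Fin 3 → ℝ) : ℝ := (Matrix.of ![x, y, w]).det

/-- A positively oriented orthonormal frame `X, Y, l` with `X` time-like. -/
structure IsPosOrthonormalFrame (X Y l : Fin 3 → ℝ) : Prop where
  XX : mink X X = -1
  YY : mink Y Y = 1
  ll : mink l l = 1
  XY : mink X Y = 0
  Xl : mink X l = 0
  Yl : mink Y l = 0
  pos : 0 < vol X Y l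

/-- The Lorentzian cross product, characterized by `⟨x × y, w⟩ = det (x, y, w)`. -/
def lcross (x y : Fin 3 → ℝ) : Fin 3 → ℝ :=
  ![x 1 * y 2 - x 2 * y 1, x 2 * y 0 - x 0 * y 2, -(x 0 * y 1 - x 1 * y 0)]

theorem mink_lcross (x y w : Fin 3 → ℝ) : mink (lcross x y) w = vol x y w := by
  simp only [mink, lcross, vol, Matrix.det_fin_three]
  simp
  ring

section Partial

variable {V : Type*} [NormedAddCommGroup V] [NormedSpace ℝ V]

/-- The partial derivative `f_u` at `p = (u, v)`. -/
def du (f : ℝ × ℝ → V) (p : ℝ × ℝ) : V := fderiv ℝ f p (1, 0)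

/-- The partial derivative `f_v` at `p = (u, v)`. -/
def dv (f : ℝ × ℝ → V) (p : ℝ × ℝ) : V := fderiv ℝ f p (0, 1)

end Partial

section Surface

/-! The quantities below belong to a parametrized surface `z = z(u, v)` at the point `p = (u, v)`. -/

variable (z : ℝ × ℝ → (Fin 3 → ℝ)) (p : ℝ × ℝ)

/-- First fundamental form: `E = ⟨z_u, z_u⟩`. -/
def formE : ℝ := mink (du z p) (du z p)

/-- First fundamental form: `F = ⟨z_u, z_v⟩`. -/
def formF : ℝ := mink (du z p) (dv z p)

/-- First fundamental form: `G = ⟨z_v, z_v⟩`. -/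
def formG : ℝ := mink (dv z p) (dv z p)

/-- The unit vector field `X = z_u / √(-E)`. -/
def frameX : Fin 3 → ℝ := (√(-formE z p))⁻¹ • du z p

/-- The unit vector field `Y = z_v / √G`. -/
def frameY : Fin 3 → ℝ := (√(formG z p))⁻¹ • dv z p

/-- The unit normal vector field `l` of a time-like surface for which `X, Y, l` is positively
oriented (see `unitNormal_spec` and `unitNormal_unique`). -/
def unitNormal : Fin 3 → ℝ :=
  (√(formF z p ^ 2 - formE z p * formG z p))⁻¹ • lcross (du z p) (dv z p)

/-- Second fundamental form: `L = ⟨l, z_uu⟩`. -/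
def formL : ℝ := mink (unitNormal z p) (du (du z) p)

/-- Second fundamental form: `M = ⟨l, z_uv⟩`. -/
def formM : ℝ := mink (unitNormal z p) (dv (du z) p)

/-- Second fundamental form: `N = ⟨l, z_vv⟩`. -/
def formN : ℝ := mink (unitNormal z p) (dv (dv z) p)

/-- The principal curvature `ν₁ = L / E` (in principal parameters). -/
def nu₁ : ℝ := formL z p / formE z p

/-- The principal curvature `ν₂ = N / G` (in principal parameters). -/
def nu₂ : ℝ := formN z p / formG z p

/-- The principal geodesic curvature `γ₁ = E_v / (2 E √G)` (in principal parameters). -/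
def gamma₁ : ℝ := dv (formE z) p / (2 * formE z p * √(formG z p))

/-- The principal geodesic curvature `γ₂ = -G_u / (2 G √(-E))` (in principal parameters). -/
def gamma₂ : ℝ := -du (formG z) p / (2 * formG z p * √(-formE z p))

end Surface

/-- `z` is a time-like surface on `D` (with `E < 0 < G`), parametrized by principal parameters and
strongly regular: `(ν₁ - ν₂) γ₁ γ₂ ≠ 0` everywhere. `C²` is the least smoothness for which the
second fundamental form is defined. The conditions give `E G - F² < 0`, so `z` is an immersion. -/
structure IsStronglyRegular (z : ℝ × ℝ → (Fin 3 → ℝ)) (D : Set (ℝ × ℝ)) : Prop where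
  smooth : ContDiffOn ℝ 2 z D
  E_neg : ∀ p ∈ D, formE z p < 0
  G_pos : ∀ p ∈ D, 0 < formG z p
  F_zero : ∀ p ∈ D, formF z p = 0
  M_zero : ∀ p ∈ D, formM z p = 0
  regular : ∀ p ∈ D, (nu₁ z p - nu₂ z p) * gamma₁ z p * gamma₂ z p ≠ 0

/-- `z` is a strongly regular time-like surface on `D` with invariants `ν₁, ν₂, γ₁, γ₂`, whose
frame at `p₀` is `z₀, X₀, Y₀, l₀`. -/
structure IsSolution (ν₁ ν₂ γ₁ γ₂ : ℝ × ℝ → ℝ) (p₀ : ℝ × ℝ) (z₀ X₀ Y₀ l₀ : Fin 3 → ℝ)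
    (z : ℝ × ℝ → (Fin 3 → ℝ)) (D : Set (ℝ × ℝ)) : Prop where
  stronglyRegular : IsStronglyRegular z D
  nu₁_eq : ∀ p ∈ D, nu₁ z p = ν₁ p
  nu₂_eq : ∀ p ∈ D, nu₂ z p = ν₂ p
  gamma₁_eq : ∀ p ∈ D, gamma₁ z p = γ₁ p
  gamma₂_eq : ∀ p ∈ D, gamma₂ z p = γ₂ p
  z_init : z p₀ = z₀
  X_init : frameX z p₀ = X₀
  Y_init : frameY z p₀ = Y₀
  l_init : unitNormal z p₀ = l₀

section Check

theorem mink_smul_left (c : ℝ) (x y : Fin 3 → ℝ) : mink (c • x) y = c * mink x y := by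
  simp only [mink, Pi.smul_apply, smul_eq_mul]; ring

theorem mink_smul_right (c : ℝ) (x y : Fin 3 → ℝ) : mink x (c • y) = c * mink x y := by
  simp only [mink, Pi.smul_apply, smul_eq_mul]; ring

theorem vol_smul (a b c : ℝ) (x y w : Fin 3 → ℝ) :
    vol (a • x) (b • y) (c • w) = a * b * c * vol x y w := by
  simp only [vol, Matrix.det_fin_three]
  simp
  ring

theorem mink_lcross_self (x y : Fin 3 → ℝ) :
    mink (lcross x y) (lcross x y) = mink x y ^ 2 - mink x x * mink y y := by
  simp only [mink, lcross]
  simp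
  ring

/-- In orthogonal parameters with `E < 0 < G`, the fields `X, Y, l` form a positively oriented
orthonormal frame. -/
theorem unitNormal_spec (z : ℝ × ℝ → (Fin 3 → ℝ)) (p : ℝ × ℝ) (hE : formE z p < 0)
    (hG : 0 < formG z p) (hF : formF z p = 0) :
    IsPosOrthonormalFrame (frameX z p) (frameY z p) (unitNormal z p) := by
  have hΔ : 0 < formF z p ^ 2 - formE z p * formG z p := by nlinarith
  have hE' : 0 < -formE z p := by linarith
  have sE := Real.sq_sqrt hE'.le
  have sG := Real.sq_sqrt hG.le
  have sΔ := Real.sq_sqrt hΔ.le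
  have pE := Real.sqrt_pos.2 hE'
  have pG := Real.sqrt_pos.2 hG
  have pΔ := Real.sqrt_pos.2 hΔ
  have hc := mink_lcross_self (du z p) (dv z p)
  have hv : vol (du z p) (dv z p) (lcross (du z p) (dv z p))
      = formF z p ^ 2 - formE z p * formG z p := by
    rw [← mink_lcross, hc]; rfl
  constructor
  · rw [frameX, mink_smul_left, mink_smul_right]
    change _ * (_ * formE z p) = _
    field_simp
    linarith
  · rw [frameY, mink_smul_left, mink_smul_right]
    change _ * (_ * formG z p) = _
    field_simp
    linarith
  · rw [unitNormal, mink_smul_left, mink_smul_right, hc]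
    change _ * (_ * (formF z p ^ 2 - formE z p * formG z p)) = _
    field_simp
    linarith
  · rw [frameX, frameY, mink_smul_left, mink_smul_right]
    change _ * (_ * formF z p) = _
    rw [hF]; ring
  · rw [frameX, unitNormal, mink_smul_left, mink_smul_right]
    have : mink (du z p) (lcross (du z p) (dv z p)) = 0 := by
      simp only [mink, lcross]; simp; ring
    rw [this]; ring
  · rw [frameY, unitNormal, mink_smul_left, mink_smul_right]
    have : mink (dv z p) (lcross (du z p) (dv z p)) = 0 := by
      simp only [mink, lcross]; simp; ring
    rw [this]; ring
  · rw [frameX, frameY, unitNormal, vol_smul, hv]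
    positivity

/-- The unit normal vector making `z_u, z_v, l` positively oriented is `unitNormal`. -/
theorem unitNormal_unique (z : ℝ × ℝ → (Fin 3 → ℝ)) (p : ℝ × ℝ) (w : Fin 3 → ℝ)
    (hΔ : formE z p * formG z p - formF z p ^ 2 < 0)
    (hu : mink (du z p) w = 0) (hv : mink (dv z p) w = 0) (hw : mink w w = 1)
    (hpos : 0 < vol (du z p) (dv z p) w) : w = unitNormal z p := by
  have hΔ' : 0 < formF z p ^ 2 - formE z p * formG z p := by linarith
  have key : ∀ i, (formF z p ^ 2 - formE z p * formG z p) * w i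
      = vol (du z p) (dv z p) w * lcross (du z p) (dv z p) i
        - (formG z p * mink (du z p) w - formF z p * mink (dv z p) w) * du z p i
        - (formE z p * mink (dv z p) w - formF z p * mink (du z p) w) * dv z p i := by
    intro i
    rw [← mink_lcross]
    fin_cases i <;> simp [formE, formF, formG, mink, lcross] <;> ring
  have key' : (formF z p ^ 2 - formE z p * formG z p) • w
      = vol (du z p) (dv z p) w • lcross (du z p) (dv z p) := by
    funext i
    have := key i
    rw [hu, hv] at this
    simpa using this
  have hsq : vol (du z p) (dv z p) w ^ 2 = formF z p ^ 2 - formE z p * formG z p := by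
    have h1 := congrArg (fun x => mink x w) key'
    simp only [mink_smul_left, mink_lcross, hw] at h1
    linarith
  have hs : √(formF z p ^ 2 - formE z p * formG z p) = vol (du z p) (dv z p) w := by
    rw [← hsq, Real.sqrt_sq hpos.le]
  rw [unitNormal, hs, eq_inv_smul_iff₀ hpos.ne']
  rw [← hsq, pow_two, mul_smul] at key'
  exact smul_right_injective _ hpos.ne' key'

end Check

end TimelikeSurface

end

open TimelikeSurface

/-! Put `a = √(-E)` and `b = √G`. In principal parameters the frame `W = (z, X, Y, l)` satisfies a
linear total differential equation `dW = ω W` whose coefficients are `a`, `b` and their products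
with the invariants (`IsStronglyRegular.frame_equations`). The form `ω` is flat if `a_v = γ₁ab`,
`b_u = -γ₂ab`, the Codazzi equations `(ν₁)_v = -(ν₁-ν₂)γ₁b`, `(ν₂)_u = -(ν₁-ν₂)γ₂a` and the Gauss
equation hold (`flat_frameForm`). Strong regularity lets one solve the Codazzi equations for `a` and
`b`, so the invariants alone determine `ω`.

Existence: define `a` and `b` by the Codazzi equations. Condition 1 makes them positive, 2.1 becomes
the equations for `a_v` and `b_u`, and 2.2 becomes the Gauss equation. The flat equation is solved
near the base point by integrating along rays (`exists_hasFDerivAt_of_flat`), and `W` gains one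
derivative over `ω`. The frame stays orthonormal (`gram_const`), and the invariants of `z` can then
be read off (`isSolution_of_frame`).

Uniqueness: the frame of a `C²` surface is only `C¹`, but `l_u = -ν₁aX` and `l_v = -ν₂bY` have `C¹`
right-hand sides, so `l` is `C²` and the symmetry of its second derivative gives the Codazzi
equations (`IsSolution.codazzi`). Two surfaces with the same invariants thus share `a`, `b` and `ω`,
and `eqOn_of_hasFDerivAt_flip` identifies their frames. -/

open Set Metric Filter Topology

/-! ### Linear total differential equations `dW = ω W`. -/

section LinearTotalDifferential

variable {P E : Type*} [NormedAddCommGroup P] [NormedSpace ℝ P]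
  [NormedAddCommGroup E] [NormedSpace ℝ E]

theorem exists_linear_ode_solution [CompleteSpace E] {B : ℝ → E →L[ℝ] E}
    (hB : ContinuousOn B (Icc 0 1)) (hb : ∀ t ∈ Icc (0 : ℝ) 1, ‖B t‖ ≤ 1 / 2) (x₀ : E) :
    ∃ α : ℝ → E, α 0 = x₀ ∧
      (∀ t ∈ Icc (0 : ℝ) 1, HasDerivWithinAt α (B t (α t)) (Icc 0 1) t) ∧
      ∀ t ∈ Icc (0 : ℝ) 1, ‖α t‖ ≤ ‖x₀‖ * Real.exp 1 := by
  -- Points of the ball of radius `‖x₀‖` about `x₀` have norm at most `2‖x₀‖`, so `‖B t‖ ≤ 1/2`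
  -- bounds the speed by `‖x₀‖`: the solution stays in the ball up to time 1 and no local solutions
  -- need gluing.
  have hPL : IsPicardLindelof (fun t x => B t x) (⟨0, by simp⟩ : Icc (0 : ℝ) 1) x₀
      ‖x₀‖₊ 0 ‖x₀‖₊ 1 := by
    refine ⟨fun t ht => ?_, fun x _ => ?_, fun t ht x hx => ?_, by simp⟩
    · refine ((B t).lipschitz.weaken ?_).lipschitzOnWith
      rw [← NNReal.coe_le_coe]
      simpa using (hb t ht).trans (by norm_num)
    · exact hB.clm_apply continuousOn_const
    · have h1 : ‖x‖ ≤ ‖x₀‖ + ‖x₀‖ := by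
        have := norm_le_norm_add_norm_sub' x x₀
        rw [mem_closedBall, dist_eq_norm] at hx
        exact this.trans (add_le_add le_rfl hx)
      have := (B t).le_of_opNorm_le_of_le (hb t ht) h1
      refine this.trans (le_of_eq ?_)
      rw [coe_nnnorm]; ring
  obtain ⟨α, h0, hα⟩ := hPL.exists_eq_forall_mem_Icc_hasDerivWithinAt₀
  refine ⟨α, h0, hα, fun t ht => ?_⟩
  have hc : ContinuousOn α (Icc 0 1) := fun t ht => (hα t ht).continuousWithinAt
  have := norm_le_gronwallBound_of_norm_deriv_right_le (f' := fun t => B t (α t))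
    (δ := ‖x₀‖) (K := 1) (ε := 0) hc
    (fun t ht => (hα t (Ico_subset_Icc_self ht)).mono_of_mem_nhdsWithin
      (Icc_mem_nhdsGE_of_mem ht))
    (by rw [h0])
    (fun t ht => by
      have := (B t).le_of_opNorm_le (hb t (Ico_subset_Icc_self ht)) (α t)
      have := norm_nonneg (α t)
      linarith) t ht
  rw [gronwallBound_ε0] at this
  refine this.trans (mul_le_mul_of_nonneg_left (Real.exp_le_exp.2 ?_) (norm_nonneg _))
  linarith [ht.2]

theorem exists_norm_bound_of_isCompact {X F : Type*} [TopologicalSpace X] [NormedAddCommGroup F]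
    [NormedSpace ℝ F] {f : X → P →L[ℝ] F} {K : Set X} (hK : IsCompact K) (hf : ContinuousOn f K) :
    ∃ C, 0 ≤ C ∧ ∀ x ∈ K, ‖f x‖ ≤ C := by
  obtain ⟨C, hC⟩ := hK.exists_bound_of_continuousOn hf
  exact ⟨max C 0, le_max_right _ _, fun x hx => (hC x hx).trans (le_max_left _ _)⟩

/-- The mean value inequality with a derivative that is uniformly continuous on the compact set. One
`δ` has to serve all points of a ray at once. -/
theorem exists_uniform_linear_approx {F : Type*} [NormedAddCommGroup F] [NormedSpace ℝ F]
    {f : P → F} {f' : P → P →L[ℝ] F} {K : Set P} (hK : IsCompact K) (hKc : Convex ℝ K)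
    (hf : ∀ x ∈ K, HasFDerivAt f (f' x) x) (hf' : ContinuousOn f' K) {η : ℝ} (hη : 0 < η) :
    ∃ δ > 0, ∀ x ∈ K, ∀ y ∈ K, ‖y - x‖ < δ → ‖f y - f x - f' x (y - x)‖ ≤ η * ‖y - x‖ := by
  have hu := hK.uniformContinuousOn_of_continuous hf'
  obtain ⟨δ, hδ, H⟩ := Metric.uniformContinuousOn_iff.1 hu η hη
  refine ⟨δ, hδ, fun x hx y hy hxy => ?_⟩
  refine (hKc.inter (convex_ball x δ)).norm_image_sub_le_of_norm_hasFDerivWithin_le'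
    (f' := f') (fun z hz => (hf z hz.1).hasFDerivWithinAt) (fun z hz => ?_)
    ⟨hx, mem_ball_self hδ⟩ ⟨hy, by rwa [mem_ball, dist_eq_norm]⟩
  rw [← dist_eq_norm]
  exact (H z hz.1 x hx hz.2).le

/-- The total differential equation `dW = ω W` in a Banach algebra is solvable near a point if `ω` is
of class `C¹` and flat. -/
theorem exists_hasFDerivAt_mul_of_flat [ProperSpace P] {A : Type*} [NormedRing A]
    [NormedAlgebra ℝ A] [CompleteSpace A] {ω : P → P →L[ℝ] A} {D : Set P} (hD : IsOpen D) (hω : ContDiffOn ℝ 1 ω D)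
    (flat : ∀ p ∈ D, ∀ h k, fderiv ℝ ω p k h + ω p h * ω p k
      = fderiv ℝ ω p h k + ω p k * ω p h)
    {p₀ : P} (hp₀ : p₀ ∈ D) (W₀ : A) :
    ∃ r > 0, ball p₀ r ⊆ D ∧ ∃ W : P → A, W p₀ = W₀ ∧
      ∀ p ∈ ball p₀ r, HasFDerivAt W ((ContinuousLinearMap.mul ℝ A).flip (W p) ∘L ω p) p := by
  obtain ⟨R, hR, hRD⟩ := nhds_basis_closedBall.mem_iff.1 (hD.mem_nhds hp₀)
  have hdiff : ∀ p ∈ D, HasFDerivAt ω (fderiv ℝ ω p) p := fun p hp =>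
    ((hω.differentiableOn (by norm_num)).differentiableAt (hD.mem_nhds hp)).hasFDerivAt
  have hcont' : ContinuousOn (fderiv ℝ ω) D := hω.continuousOn_fderiv_of_isOpen hD le_rfl
  obtain ⟨C, hC0, hC⟩ := exists_norm_bound_of_isCompact (isCompact_closedBall p₀ R)
    (hω.continuousOn.mono hRD)
  -- With `C * r ≤ 1/2` the equation along every ray of length at most `r` meets the bound in
  -- `exists_linear_ode_solution`.
  obtain ⟨r, hr, hrR, hCr⟩ : ∃ r > 0, r ≤ R ∧ C * r ≤ 1 / 2 := by
    refine ⟨min R (1 / (2 * (C + 1))), by positivity, min_le_left _ _, ?_⟩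
    calc C * min R (1 / (2 * (C + 1))) ≤ (C + 1) * (1 / (2 * (C + 1))) := by
          gcongr
          · linarith
          · exact min_le_right _ _
      _ = 1 / 2 := by field_simp
  have hsub : closedBall p₀ r ⊆ closedBall p₀ R := closedBall_subset_closedBall hrR
  have hsubD := hsub.trans hRD
  obtain ⟨C₁, hC₁0, hC₁⟩ := exists_norm_bound_of_isCompact (isCompact_closedBall p₀ r) (hcont'.mono hsubD)
  have hmem : ∀ w : P, ‖w‖ ≤ r → ∀ t ∈ Icc (0 : ℝ) 1, p₀ + t • w ∈ closedBall p₀ r := by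
    intro w hw t ht
    rw [mem_closedBall, dist_eq_norm, add_sub_cancel_left, norm_smul, Real.norm_of_nonneg ht.1]
    nlinarith [norm_nonneg w, ht.2]
  have hq : ∀ (w : P) (t : ℝ), HasDerivAt (fun t : ℝ => p₀ + t • w) w t := fun w t => by
    simpa using ((hasDerivAt_id t).smul_const w).const_add p₀
  have hex : ∀ w : P, ∃ α : ℝ → A, ‖w‖ ≤ r → α 0 = W₀ ∧
      (∀ t ∈ Icc (0 : ℝ) 1, HasDerivWithinAt α (ω (p₀ + t • w) w * α t) (Icc 0 1) t) ∧
      ∀ t ∈ Icc (0 : ℝ) 1, ‖α t‖ ≤ ‖W₀‖ * Real.exp 1 := by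
    intro w
    by_cases hw : ‖w‖ ≤ r
    · obtain ⟨α, h⟩ := exists_linear_ode_solution (B := fun t => ContinuousLinearMap.mul ℝ A (ω (p₀ + t • w) w))
        ((ContinuousLinearMap.continuous _).comp_continuousOn ((hω.continuousOn.comp (by fun_prop)
          (fun t ht => hsubD (hmem w hw t ht))).clm_apply continuousOn_const))
        (fun t ht => (ContinuousLinearMap.opNorm_mul_apply_le _ _ _).trans <| ((ω _).le_of_opNorm_le_of_le (hC _ (hsub (hmem w hw t ht))) hw).trans hCr) W₀
      exact ⟨α, fun _ => h⟩
    · exact ⟨0, fun h => absurd h hw⟩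
  choose Ψ hΨ using hex
  set S := ‖W₀‖ * Real.exp 1 with hS
  have hS0 : 0 ≤ S := by positivity
  refine ⟨r, hr, ball_subset_closedBall.trans hsubD, fun p => Ψ (p - p₀) 1, ?_, ?_⟩
  · obtain ⟨h0, hd, -⟩ := hΨ 0 (by simpa using hr.le)
    -- The ray with direction `0` carries the equation `α' = 0`, so its endpoint is still `W₀`.
    have := eq_zero_of_abs_deriv_le_mul_abs_self_of_eq_zero_right (f := fun t => Ψ 0 t - W₀)
      (f' := fun _ => 0) (K := 0) (a := 0) (b := 1)
      (fun t ht => ((hd t ht).continuousWithinAt).sub continuousWithinAt_const)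
      (fun t ht => by
        simpa using ((hd t (Ico_subset_Icc_self ht)).mono_of_mem_nhdsWithin
          (Icc_mem_nhdsGE_of_mem ht)).sub_const W₀)
      (by simp [h0]) (by simp) 1 (by simp)
    simpa [sub_eq_zero] using this
  intro p hp
  set w := p - p₀ with hw
  have hwr : ‖w‖ < r := by rwa [mem_ball, dist_eq_norm] at hp
  have hpw : p₀ + w = p := by simp [hw]
  rw [hasFDerivAt_iff_isLittleO_nhds_zero, Asymptotics.isLittleO_iff]
  intro c hc
  -- `M` collects the constants of the error terms `e1`, `e2`, `e3` below. The factor 2 in the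
  -- choice of `η` absorbs `e - 1` from Grönwall.
  set M := S * (r + C₁ + (C₁ * r + C) * C + 1) with hM
  have hM0 : 0 ≤ M := by positivity
  obtain ⟨η, hη, hη1⟩ : ∃ η > 0, η * M * 2 ≤ c := by
    refine ⟨c / (2 * (M + 1)), by positivity, ?_⟩
    rw [div_mul_eq_mul_div, div_mul_eq_mul_div, div_le_iff₀ (by positivity)]
    nlinarith
  obtain ⟨δ, hδ, hap⟩ := exists_uniform_linear_approx (isCompact_closedBall p₀ r)
    (convex_closedBall p₀ r) (fun x hx => hdiff x (hsubD hx)) (hcont'.mono hsubD) hη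
  -- `‖k‖ < δ` activates the linear approximation, `‖k‖ < η` turns quadratic errors into `η‖k‖`, and
  -- the last bound keeps `w + k` in the ball.
  filter_upwards [ball_mem_nhds (0 : P) (show 0 < min (min δ η) (r - ‖w‖) from
    lt_min (lt_min hδ hη) (sub_pos.2 hwr))] with k hk
  rw [mem_ball_zero_iff, lt_min_iff, lt_min_iff] at hk
  obtain ⟨⟨hkδ, hkη⟩, hkr⟩ := hk
  have hwk : ‖w + k‖ ≤ r := (norm_add_le _ _).trans (by linarith)
  obtain ⟨h0, hd, hb⟩ := hΨ w hwr.le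
  obtain ⟨h0', hd', -⟩ := hΨ (w + k) hwk
  -- Replacing `w` by `w + k` moves the point at time `t` by `t • k`. `R` is the error of the
  -- predicted change `ω(t • k) Ψ`; it vanishes at `0`, and `R 1 = o(k)` is the differentiability
  -- claim.
  set R : ℝ → A := fun t =>
    Ψ (w + k) t - Ψ w t - ω (p₀ + t • w) (t • k) * Ψ w t with hRdef
  set R' : ℝ → A := fun t => ω (p₀ + t • (w + k)) (w + k) * Ψ (w + k) t
    - ω (p₀ + t • w) w * Ψ w t
    - ((fderiv ℝ ω (p₀ + t • w) w (t • k) + ω (p₀ + t • w) k) * Ψ w t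
      + ω (p₀ + t • w) (t • k) * (ω (p₀ + t • w) w * Ψ w t)) with hR'def
  have hRd : ∀ t ∈ Icc (0 : ℝ) 1, HasDerivWithinAt R (R' t) (Icc 0 1) t := by
    intro t ht
    refine ((hd' t ht).sub (hd t ht)).sub ?_
    refine HasDerivWithinAt.mul ?_ (hd t ht)
    have h1 : HasDerivAt (fun t : ℝ => ω (p₀ + t • w)) (fderiv ℝ ω (p₀ + t • w) w) t :=
      (hdiff _ (hsubD (hmem w hwr.le t ht))).comp_hasDerivAt t (hq w t)
    have h2 : HasDerivAt (fun t : ℝ => t • k) k t := by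
      simpa using (hasDerivAt_id t).smul_const k
    exact (h1.clm_apply h2).hasDerivWithinAt
  have hR0 : R 0 = 0 := by simp [hRdef, h0, h0']
  have hbound : ∀ t ∈ Ico (0 : ℝ) 1, ‖R' t‖ ≤ 1 * ‖R t‖ + η * M * ‖k‖ := by
    intro t ht'
    have ht := Ico_subset_Icc_self ht'
    set q := p₀ + t • w with hqd
    set q' := p₀ + t • (w + k) with hqd'
    have hqm := hmem w hwr.le t ht
    have hqm' := hmem (w + k) hwk t ht
    have hqq : q' - q = t • k := by simp [hqd, hqd', smul_add]
    have htk : ‖t • k‖ ≤ ‖k‖ := by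
      rw [norm_smul, Real.norm_of_nonneg ht.1]
      nlinarith [norm_nonneg k, ht.2]
    have happ := hap q hqm q' hqm' (by rw [hqq]; linarith)
    have hlip : ‖ω q' - ω q‖ ≤ C₁ * ‖k‖ := by
      have := (convex_closedBall p₀ r).norm_image_sub_le_of_norm_hasFDerivWithin_le
        (fun x hx => (hdiff x (hsubD hx)).hasFDerivWithinAt) hC₁ hqm hqm'
      rw [hqq] at this
      exact this.trans (by gcongr)
    rw [hqq] at happ
    -- Flatness exchanges `w` and `t • k` in the derivative of `ω`, which turns `R'` into `ω q' (w +
    -- k) * R` plus terms that are small compared with `k`.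
    have hfl := flat q (hsubD hqm) w (t • k)
    have key : R' t = ω q' (w + k) * R t
        + ((ω q' - ω q - fderiv ℝ ω q (t • k)) w * Ψ w t + (ω q' - ω q) k * Ψ w t
          + ((ω q' - ω q) w + ω q' k) * (ω q (t • k) * Ψ w t)) := by
      simp only [hR'def, hRdef, sub_apply, map_add, ← hqd, ← hqd']
      rw [eq_sub_iff_add_eq.2 hfl]
      noncomm_ring
    have mul_le : ∀ {x y : A} {s t : ℝ}, ‖x‖ ≤ s → ‖y‖ ≤ t → ‖x * y‖ ≤ s * t := fun hx hy =>
      (norm_mul_le _ _).trans (mul_le_mul hx hy (norm_nonneg _) ((norm_nonneg _).trans hx))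
    have e0 : ‖ω q' (w + k) * R t‖ ≤ 1 * ‖R t‖ :=
      mul_le (((ω q').le_of_opNorm_le_of_le (hC _ (hsub hqm')) hwk).trans
        (hCr.trans (by norm_num))) le_rfl
    have e1 : ‖(ω q' - ω q - fderiv ℝ ω q (t • k)) w * Ψ w t‖ ≤ η * ‖k‖ * r * S :=
      mul_le (ContinuousLinearMap.le_of_opNorm_le_of_le _
        (happ.trans (by gcongr)) hwr.le) (hb t ht)
    have e2 : ‖(ω q' - ω q) k * Ψ w t‖ ≤ C₁ * ‖k‖ * η * S :=
      mul_le (ContinuousLinearMap.le_of_opNorm_le_of_le _ hlip hkη.le) (hb t ht)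
    have e3 : ‖((ω q' - ω q) w + ω q' k) * (ω q (t • k) * Ψ w t)‖
        ≤ (C₁ * η * r + C * η) * (C * ‖k‖ * S) := by
      refine mul_le ((norm_add_le _ _).trans (add_le_add ?_ ?_)) (mul_le ?_ (hb t ht))
      · exact ContinuousLinearMap.le_of_opNorm_le_of_le _ (hlip.trans (by gcongr)) hwr.le
      · exact ContinuousLinearMap.le_of_opNorm_le_of_le _ (hC _ (hsub hqm')) hkη.le
      · exact ContinuousLinearMap.le_of_opNorm_le_of_le _ (hC _ (hsub hqm)) htk
    rw [key]
    refine (norm_add_le _ _).trans (add_le_add e0 ((norm_add₃_le).trans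
      ((add_le_add (add_le_add e1 e2) e3).trans ?_)))
    have : 0 ≤ η * ‖k‖ * S := by positivity
    rw [hM]
    nlinarith
  have hfin := norm_le_gronwallBound_of_norm_deriv_right_le (f := R) (f' := R') (δ := 0) (K := 1)
    (ε := η * M * ‖k‖) (fun t ht => (hRd t ht).continuousWithinAt)
    (fun t ht => (hRd t (Ico_subset_Icc_self ht)).mono_of_mem_nhdsWithin
      (Icc_mem_nhdsGE_of_mem ht)) (by simp [hR0]) hbound 1 (by simp)
  rw [gronwallBound_of_K_ne_0 one_ne_zero] at hfin
  have hR1 : R 1 = Ψ (p + k - p₀) 1 - Ψ (p - p₀) 1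
      - ((ContinuousLinearMap.mul ℝ A).flip (Ψ (p - p₀) 1) ∘L ω p) k := by
    have : p + k - p₀ = w + k := by rw [hw]; abel
    simp only [hRdef, this, hpw, one_smul, ContinuousLinearMap.comp_apply,
      ContinuousLinearMap.flip_apply, ContinuousLinearMap.mul_apply', ← hw]
  rw [← hw] at hR1 ⊢
  rw [← hR1]
  refine hfin.trans ?_
  have hexp : Real.exp 1 - 1 ≤ 2 := by linarith [Real.exp_one_lt_d9]
  have h1 : 0 ≤ η * M * ‖k‖ := by positivity
  simp only [sub_zero, mul_one, zero_mul, zero_add, div_one]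
  calc η * M * ‖k‖ * (Real.exp 1 - 1) ≤ η * M * ‖k‖ * 2 := by gcongr
    _ = η * M * 2 * ‖k‖ := by ring
    _ ≤ c * ‖k‖ := by gcongr

/-- The total differential equation `dW = ω W` is solvable near a point if `ω` is of class `C¹` and
flat. -/
theorem exists_hasFDerivAt_of_flat [ProperSpace P] [CompleteSpace E]
    {ω : P → P →L[ℝ] E →L[ℝ] E} {D : Set P} (hD : IsOpen D) (hω : ContDiffOn ℝ 1 ω D)
    (flat : ∀ p ∈ D, ∀ h k, fderiv ℝ ω p k h + ω p h ∘L ω p k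
      = fderiv ℝ ω p h k + ω p k ∘L ω p h)
    {p₀ : P} (hp₀ : p₀ ∈ D) (W₀ : E) :
    ∃ r > 0, ball p₀ r ⊆ D ∧ ∃ W : P → E, W p₀ = W₀ ∧
      ∀ p ∈ ball p₀ r, HasFDerivAt W ((ω p).flip (W p)) p := by
  -- Solve for the fundamental solution in the algebra of endomorphisms and apply it to `W₀`.
  obtain ⟨r, hr, hrD, Φ, h0, hΦ⟩ := exists_hasFDerivAt_mul_of_flat hD hω flat hp₀
    (ContinuousLinearMap.id ℝ E)
  refine ⟨r, hr, hrD, fun p => Φ p W₀, by simp [h0], fun p hp => ?_⟩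
  have := (ContinuousLinearMap.apply ℝ E W₀).hasFDerivAt.comp p (hΦ p hp)
  exact this

/-- A function on a connected open set that vanishes somewhere and whose differential is locally
bounded by a multiple of the function vanishes identically. -/
theorem eqOn_zero_of_norm_fderiv_le {F : Type*} [NormedAddCommGroup F] [NormedSpace ℝ F]
    {f : P → F} {D : Set P} (hD : IsOpen D) (hDc : IsPreconnected D)
    (hf : DifferentiableOn ℝ f D)
    (hb : ∀ p ∈ D, ∃ C, ∀ᶠ q in 𝓝 p, ‖fderiv ℝ f q‖ ≤ C * ‖f q‖)
    {p₀ : P} (hp₀ : p₀ ∈ D) (h0 : f p₀ = 0) : EqOn f 0 D := by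
  -- Grönwall along segments: inside a small ball one zero forces all values to vanish. So the zero
  -- set is open, and by continuity so is its complement in `D`.
  have hball : ∀ p ∈ D, ∃ r > 0, ∀ q ∈ ball p r, ∀ q' ∈ ball p r, f q = 0 → f q' = 0 := by
    intro p hp
    obtain ⟨C, hC⟩ := hb p hp
    obtain ⟨r, hr, hrs⟩ := Metric.mem_nhds_iff.1 (hC.and (hD.mem_nhds hp) : _ ∈ 𝓝 p)
    refine ⟨r, hr, fun q hq q' hq' hfq => ?_⟩
    have hseg : ∀ t ∈ Icc (0 : ℝ) 1, q + t • (q' - q) ∈ ball p r := fun t ht =>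
      (convex_ball p r).add_smul_sub_mem hq hq' ht
    have hder : ∀ t ∈ Icc (0 : ℝ) 1, HasDerivAt (fun t : ℝ => f (q + t • (q' - q)))
        (fderiv ℝ f (q + t • (q' - q)) (q' - q)) t := by
      intro t ht
      have h1 : HasDerivAt (fun t : ℝ => q + t • (q' - q)) (q' - q) t := by
        simpa using ((hasDerivAt_id t).smul_const (q' - q)).const_add q
      have hm := (hrs (hseg t ht)).2
      exact ((hf.differentiableAt (hD.mem_nhds hm)).hasFDerivAt).comp_hasDerivAt t h1
    have := eq_zero_of_abs_deriv_le_mul_abs_self_of_eq_zero_right (K := C * ‖q' - q‖)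
      (fun t ht => (hder t ht).continuousAt.continuousWithinAt)
      (fun t ht => (hder t (Ico_subset_Icc_self ht)).hasDerivWithinAt)
      (by simpa using hfq)
      (fun t ht => by
        have := ContinuousLinearMap.le_of_opNorm_le _
          (hrs (hseg t (Ico_subset_Icc_self ht))).1 (q' - q)
        calc _ ≤ _ := this
          _ = _ := by ring) 1 (by simp)
    simpa using this
  by_contra hne
  obtain ⟨p₁, hp₁, hp₁0⟩ : ∃ p ∈ D, f p ≠ 0 := by
    by_contra! h
    exact hne fun p hp => h p hp
  have hop1 : IsOpen {p | p ∈ D ∧ f p = 0} := by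
    rw [Metric.isOpen_iff]
    rintro p ⟨hp, hfp⟩
    obtain ⟨r, hr, H⟩ := hball p hp
    obtain ⟨r', hr', H'⟩ := Metric.isOpen_iff.1 hD p hp
    exact ⟨min r r', lt_min hr hr', fun q hq => ⟨H' (ball_subset_ball (min_le_right _ _) hq),
      H p (mem_ball_self hr) q (ball_subset_ball (min_le_left _ _) hq) hfp⟩⟩
  have hop2 : IsOpen {p | p ∈ D ∧ f p ≠ 0} :=
    hf.continuousOn.isOpen_inter_preimage hD isOpen_ne
  obtain ⟨p, -, ⟨-, h1⟩, ⟨-, h2⟩⟩ := hDc _ _ hop1 hop2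
    (fun p hp => by
      by_cases h : f p = 0
      · exact Or.inl ⟨hp, h⟩
      · exact Or.inr ⟨hp, h⟩)
    ⟨p₀, hp₀, hp₀, h0⟩ ⟨p₁, hp₁, hp₁, hp₁0⟩
  exact h2 h1

/-- Two solutions of the total differential equation `dW = ω W` with the same value at a point of a
connected open set coincide there. -/
theorem eqOn_of_hasFDerivAt_flip {ω : P → P →L[ℝ] E →L[ℝ] E} {D : Set P} (hD : IsOpen D)
    (hDc : IsPreconnected D) (hω : ContinuousOn ω D) {W W' : P → E}
    (hW : ∀ p ∈ D, HasFDerivAt W ((ω p).flip (W p)) p)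
    (hW' : ∀ p ∈ D, HasFDerivAt W' ((ω p).flip (W' p)) p)
    {p₀ : P} (hp₀ : p₀ ∈ D) (h0 : W p₀ = W' p₀) : EqOn W W' D := by
  -- By linearity the difference solves the same equation; `ω` is locally bounded because it is
  -- continuous.
  have hd : ∀ p ∈ D, HasFDerivAt (fun p => W p - W' p) ((ω p).flip (W p - W' p)) p := by
    intro p hp
    rw [map_sub]
    exact (hW p hp).sub (hW' p hp)
  have := eqOn_zero_of_norm_fderiv_le hD hDc
    (fun p hp => (hd p hp).differentiableAt.differentiableWithinAt)
    (fun p hp => by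
      have h1 : ∀ᶠ q in 𝓝 p, ‖ω q‖ < ‖ω p‖ + 1 :=
        (ContinuousAt.norm (f := ω) (hω.continuousAt (hD.mem_nhds hp))).eventually_lt_const
          (lt_add_one _)
      refine ⟨‖ω p‖ + 1, ?_⟩
      filter_upwards [h1, hD.mem_nhds hp] with q hq hqD
      rw [(hd q hqD).fderiv]
      refine (ContinuousLinearMap.le_opNorm _ _).trans ?_
      rw [ContinuousLinearMap.opNorm_flip]
      gcongr) hp₀ (sub_eq_zero.2 h0)
  intro p hp
  exact sub_eq_zero.1 (this hp)

/-- A solution of `dW = ω W` is once more differentiable than `ω`. -/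
theorem contDiffOn_succ_of_hasFDerivAt_flip {ω : P → P →L[ℝ] E →L[ℝ] E} {D : Set P}
    (hD : IsOpen D) {n : ℕ∞} (hω : ContDiffOn ℝ n ω D) {W : P → E}
    (hW : ∀ p ∈ D, HasFDerivAt W ((ω p).flip (W p)) p) :
    ContDiffOn ℝ ((n : WithTop ℕ∞) + 1) W D := by
  -- Bootstrap: if `W` is `C^m` with `m ≤ n`, then so is `dW = ω W`. The value `⊤` of `WithTop ℕ∞`
  -- is the analytic class and is excluded.
  have step : ∀ m : WithTop ℕ∞, m ≤ n → m ≠ ⊤ → ContDiffOn ℝ m W D → ContDiffOn ℝ (m + 1) W D := by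
    intro m hm hmt h
    rw [contDiffOn_succ_iff_fderiv_of_isOpen hD]
    refine ⟨fun p hp => (hW p hp).differentiableAt.differentiableWithinAt,
      fun hmw => absurd hmw hmt, ?_⟩
    have hfl : ContDiffOn ℝ m (fun p => (ω p).flip (W p)) D := by
      have := (LinearIsometryEquiv.contDiff (F := E →L[ℝ] P →L[ℝ] E)
        (ContinuousLinearMap.flipₗᵢ ℝ P E E)).comp_contDiffOn (hω.of_le hm)
      exact ContDiffOn.clm_apply this h
    exact hfl.congr fun p hp => (hW p hp).fderiv
  have hnat : ∀ m : ℕ, (m : ℕ∞) ≤ n → ContDiffOn ℝ ((m : WithTop ℕ∞) + 1) W D := by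
    intro m
    induction m with
    | zero =>
      intro _
      refine step 0 (by simp) (by simp) (contDiffOn_zero.2
        fun p hp => (hW p hp).continuousAt.continuousWithinAt)
    | succ m ih =>
      intro hm
      refine step _ (by exact_mod_cast hm) (by simp) ?_
      have := ih (le_trans (by exact_mod_cast Nat.le_succ m) hm)
      exact_mod_cast this
  induction n with
  | top =>
    have : ContDiffOn ℝ ((⊤ : ℕ∞) : WithTop ℕ∞) W D := by
      rw [contDiffOn_infty]
      exact fun m => (hnat m le_top).of_le (by simp)
    simpa using this
  | coe n => exact_mod_cast hnat n le_rfl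

end LinearTotalDifferential

namespace TimelikeSurface

/-! ### Calculus with the two partial derivatives. -/

section PartialCalculus

variable {V : Type*} [NormedAddCommGroup V] [NormedSpace ℝ V]

/-- The linear map on the parameter plane with the given partial derivatives. -/
noncomputable def partials (x y : V) : ℝ × ℝ →L[ℝ] V :=
  (ContinuousLinearMap.fst ℝ ℝ ℝ).smulRight x + (ContinuousLinearMap.snd ℝ ℝ ℝ).smulRight y

@[simp] theorem partials_apply (x y : V) (h : ℝ × ℝ) : partials x y h = h.1 • x + h.2 • y := rfl

theorem eq_partials (T : ℝ × ℝ →L[ℝ] V) : T = partials (T (1, 0)) (T (0, 1)) := by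
  ext <;> simp

theorem hasFDerivAt_partials {f : ℝ × ℝ → V} {p : ℝ × ℝ} (hf : DifferentiableAt ℝ f p) :
    HasFDerivAt f (partials (du f p) (dv f p)) p := by
  have := hf.hasFDerivAt
  rwa [eq_partials (fderiv ℝ f p)] at this

theorem du_eq_of_hasFDerivAt {f : ℝ × ℝ → V} {p : ℝ × ℝ} {x y : V}
    (h : HasFDerivAt f (partials x y) p) : du f p = x := by
  simp [du, h.fderiv]

theorem dv_eq_of_hasFDerivAt {f : ℝ × ℝ → V} {p : ℝ × ℝ} {x y : V}
    (h : HasFDerivAt f (partials x y) p) : dv f p = y := by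
  simp [dv, h.fderiv]

theorem hasFDerivAt_smul_partials {a : ℝ × ℝ → ℝ} {f : ℝ × ℝ → V} {p : ℝ × ℝ} {au av : ℝ}
    {fu fv : V} (ha : HasFDerivAt a (partials au av) p) (hf : HasFDerivAt f (partials fu fv) p) :
    HasFDerivAt (fun q => a q • f q)
      (partials (au • f p + a p • fu) (av • f p + a p • fv)) p := by
  refine (ha.smul hf).congr_fderiv (ContinuousLinearMap.ext fun h => ?_)
  simp
  module

theorem hasFDerivAt_mul_partials {a b : ℝ × ℝ → ℝ} {p : ℝ × ℝ} {au av bu bv : ℝ}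
    (ha : HasFDerivAt a (partials au av) p) (hb : HasFDerivAt b (partials bu bv) p) :
    HasFDerivAt (fun q => a q * b q)
      (partials (au * b p + a p * bu) (av * b p + a p * bv)) p :=
  hasFDerivAt_smul_partials ha hb

theorem hasFDerivAt_mink {f g : ℝ × ℝ → Fin 3 → ℝ} {p : ℝ × ℝ} {fu fv gu gv : Fin 3 → ℝ}
    (hf : HasFDerivAt f (partials fu fv) p) (hg : HasFDerivAt g (partials gu gv) p) :
    HasFDerivAt (fun q => mink (f q) (g q))
      (partials (mink fu (g p) + mink (f p) gu) (mink fv (g p) + mink (f p) gv)) p := by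
  have hf' := hasFDerivAt_pi'.1 hf
  have hg' := hasFDerivAt_pi'.1 hg
  refine ((((hf' 0).mul (hg' 0)).add ((hf' 1).mul (hg' 1))).sub
    ((hf' 2).mul (hg' 2))).congr_fderiv (ContinuousLinearMap.ext fun h => ?_)
  simp [mink]
  ring

theorem contDiffOn_du {n : WithTop ℕ∞} {f : ℝ × ℝ → V} {D : Set (ℝ × ℝ)} (hD : IsOpen D)
    (hf : ContDiffOn ℝ (n + 1) f D) : ContDiffOn ℝ n (du f) D :=
  (hf.fderiv_of_isOpen hD le_rfl).clm_apply contDiffOn_const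

theorem contDiffOn_dv {n : WithTop ℕ∞} {f : ℝ × ℝ → V} {D : Set (ℝ × ℝ)} (hD : IsOpen D)
    (hf : ContDiffOn ℝ (n + 1) f D) : ContDiffOn ℝ n (dv f) D :=
  (hf.fderiv_of_isOpen hD le_rfl).clm_apply contDiffOn_const

theorem dv_du_comm {f : ℝ × ℝ → V} {D : Set (ℝ × ℝ)} (hD : IsOpen D)
    (hf : ContDiffOn ℝ 2 f D) {p : ℝ × ℝ} (hp : p ∈ D) : dv (du f) p = du (dv f) p := by
  have hsymm := (hf.contDiffAt (hD.mem_nhds hp)).isSymmSndFDerivAt (by simp)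
  have hd : DifferentiableAt ℝ (fderiv ℝ f) p :=
    ((hf.fderiv_of_isOpen hD (m := 1) (by norm_num)).differentiableOn (by norm_num)).differentiableAt
      (hD.mem_nhds hp)
  have key : ∀ h k : ℝ × ℝ, fderiv ℝ (fun q => fderiv ℝ f q h) p k
      = fderiv ℝ (fderiv ℝ f) p k h := by
    intro h k
    rw [fderiv_clm_apply hd (differentiableAt_const h)]
    simp
  change fderiv ℝ (fun q => fderiv ℝ f q (1, 0)) p (0, 1)
    = fderiv ℝ (fun q => fderiv ℝ f q (0, 1)) p (1, 0)
  rw [key, key]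
  exact hsymm _ _

theorem du_congr {f g : ℝ × ℝ → V} {D : Set (ℝ × ℝ)} (hD : IsOpen D) (h : EqOn f g D)
    {p : ℝ × ℝ} (hp : p ∈ D) : du f p = du g p := by
  rw [du, du, (h.eventuallyEq_of_mem (hD.mem_nhds hp)).fderiv_eq]

theorem dv_congr {f g : ℝ × ℝ → V} {D : Set (ℝ × ℝ)} (hD : IsOpen D) (h : EqOn f g D)
    {p : ℝ × ℝ} (hp : p ∈ D) : dv f p = dv g p := by
  rw [dv, dv, (h.eventuallyEq_of_mem (hD.mem_nhds hp)).fderiv_eq]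

end PartialCalculus

/-! ### Algebra of the Minkowski product. -/

section Minkowski

theorem mink_comm (x y : Fin 3 → ℝ) : mink x y = mink y x := by
  simp only [mink]; ring

theorem mink_add_right (x y w : Fin 3 → ℝ) : mink w (x + y) = mink w x + mink w y := by
  simp only [mink, Pi.add_apply]; ring

theorem mink_neg_right (x w : Fin 3 → ℝ) : mink w (-x) = -mink w x := by
  simp only [mink, Pi.neg_apply]; ring

theorem mink_sub_right (x y w : Fin 3 → ℝ) : mink w (x - y) = mink w x - mink w y := by
  simp only [mink, Pi.sub_apply]; ring

/-- The matrix with rows `X, Y, l` is nonsingular and kills `w - w'` after the sign change of the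
third coordinate that encodes the signature. -/
theorem eq_of_mink_eq {X Y l w w' : Fin 3 → ℝ} (h : vol X Y l ≠ 0) (hX : mink X w = mink X w')
    (hY : mink Y w = mink Y w') (hl : mink l w = mink l w') : w = w' := by
  have := Matrix.eq_zero_of_mulVec_eq_zero (M := Matrix.of ![X, Y, l])
    (v := ![w 0 - w' 0, w 1 - w' 1, -(w 2 - w' 2)]) h (by
      funext i
      simp only [mink] at hX hY hl
      fin_cases i <;> simp [Matrix.mulVec, dotProduct, Fin.sum_univ_three] <;> linarith)
  have h0 := congrFun this 0
  have h1 := congrFun this 1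
  have h2 := congrFun this 2
  simp only [Matrix.cons_val, Pi.zero_apply] at h0 h1 h2
  funext i
  fin_cases i <;> simp <;> linarith

end Minkowski

/-! ### Derivational equations of a surface in principal parameters. -/

section FrameEquations

variable {z : ℝ × ℝ → Fin 3 → ℝ} {D : Set (ℝ × ℝ)}

theorem contDiffOn_mink {n : WithTop ℕ∞} {f g : ℝ × ℝ → Fin 3 → ℝ} (hf : ContDiffOn ℝ n f D)
    (hg : ContDiffOn ℝ n g D) : ContDiffOn ℝ n (fun q => mink (f q) (g q)) D := by
  have hf' := contDiffOn_pi.1 hf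
  have hg' := contDiffOn_pi.1 hg
  exact (((hf' 0).mul (hg' 0)).add ((hf' 1).mul (hg' 1))).sub ((hf' 2).mul (hg' 2))

theorem contDiffOn_lcross {n : WithTop ℕ∞} {f g : ℝ × ℝ → Fin 3 → ℝ} (hf : ContDiffOn ℝ n f D)
    (hg : ContDiffOn ℝ n g D) : ContDiffOn ℝ n (fun q => lcross (f q) (g q)) D := by
  have hf' := contDiffOn_pi.1 hf
  have hg' := contDiffOn_pi.1 hg
  rw [contDiffOn_pi]
  intro i
  fin_cases i
  · exact ((hf' 1).mul (hg' 2)).sub ((hf' 2).mul (hg' 1))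
  · exact ((hf' 2).mul (hg' 0)).sub ((hf' 0).mul (hg' 2))
  · exact (((hf' 0).mul (hg' 1)).sub ((hf' 1).mul (hg' 0))).neg

namespace IsStronglyRegular

theorem contDiffOn_du (h : IsStronglyRegular z D) (hD : IsOpen D) : ContDiffOn ℝ 1 (du z) D :=
  TimelikeSurface.contDiffOn_du hD (h.smooth.of_le (by norm_num))

theorem contDiffOn_dv (h : IsStronglyRegular z D) (hD : IsOpen D) : ContDiffOn ℝ 1 (dv z) D :=
  TimelikeSurface.contDiffOn_dv hD (h.smooth.of_le (by norm_num))

theorem contDiffOn_sqrt_neg_formE (h : IsStronglyRegular z D) (hD : IsOpen D) :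
    ContDiffOn ℝ 1 (fun p => √(-formE z p)) D :=
  (contDiffOn_mink (h.contDiffOn_du hD) (h.contDiffOn_du hD)).neg.sqrt
    fun p hp => (neg_pos.2 (h.E_neg p hp)).ne'

theorem contDiffOn_sqrt_formG (h : IsStronglyRegular z D) (hD : IsOpen D) :
    ContDiffOn ℝ 1 (fun p => √(formG z p)) D :=
  (contDiffOn_mink (h.contDiffOn_dv hD) (h.contDiffOn_dv hD)).sqrt
    fun p hp => (h.G_pos p hp).ne'

theorem contDiffOn_frameX (h : IsStronglyRegular z D) (hD : IsOpen D) :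
    ContDiffOn ℝ 1 (frameX z) D :=
  ((h.contDiffOn_sqrt_neg_formE hD).inv
    fun p hp => (Real.sqrt_pos.2 (neg_pos.2 (h.E_neg p hp))).ne').smul (h.contDiffOn_du hD)

theorem contDiffOn_frameY (h : IsStronglyRegular z D) (hD : IsOpen D) :
    ContDiffOn ℝ 1 (frameY z) D :=
  ((h.contDiffOn_sqrt_formG hD).inv
    fun p hp => (Real.sqrt_pos.2 (h.G_pos p hp)).ne').smul (h.contDiffOn_dv hD)

theorem contDiffOn_unitNormal (h : IsStronglyRegular z D) (hD : IsOpen D) :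
    ContDiffOn ℝ 1 (unitNormal z) D := by
  have hu := h.contDiffOn_du hD
  have hv := h.contDiffOn_dv hD
  have hΔ : ∀ p ∈ D, 0 < formF z p ^ 2 - formE z p * formG z p := fun p hp => by
    nlinarith [h.E_neg p hp, h.G_pos p hp, sq_nonneg (formF z p)]
  exact ((((contDiffOn_mink hu hv).pow 2).sub
    ((contDiffOn_mink hu hu).mul (contDiffOn_mink hv hv))).sqrt (fun p hp => (hΔ p hp).ne')).inv
      (fun p hp => (Real.sqrt_pos.2 (hΔ p hp)).ne') |>.smul (contDiffOn_lcross hu hv)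

theorem isPosOrthonormalFrame (h : IsStronglyRegular z D) {p : ℝ × ℝ} (hp : p ∈ D) :
    IsPosOrthonormalFrame (frameX z p) (frameY z p) (unitNormal z p) :=
  unitNormal_spec z p (h.E_neg p hp) (h.G_pos p hp) (h.F_zero p hp)

theorem du_eq_smul (h : IsStronglyRegular z D) :
    EqOn (du z) (fun p => √(-formE z p) • frameX z p) D := fun p hp => by
  simp only [frameX]
  rw [smul_inv_smul₀ (Real.sqrt_pos.2 (neg_pos.2 (h.E_neg p hp))).ne']

theorem dv_eq_smul (h : IsStronglyRegular z D) :
    EqOn (dv z) (fun p => √(formG z p) • frameY z p) D := fun p hp => by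
  simp only [frameY]
  rw [smul_inv_smul₀ (Real.sqrt_pos.2 (h.G_pos p hp)).ne']

end IsStronglyRegular

/-- The derivational equations for the geometric frame of a surface in principal parameters. -/
theorem IsStronglyRegular.frame_equations (h : IsStronglyRegular z D) (hD : IsOpen D)
    {p : ℝ × ℝ} (hp : p ∈ D) {a b : ℝ} (ha : a = √(-formE z p)) (hb : b = √(formG z p)) :
    du (frameX z) p = (gamma₁ z p * a) • frameY z p - (nu₁ z p * a) • unitNormal z p ∧
    dv (frameX z) p = -((gamma₂ z p * b) • frameY z p) ∧
    du (frameY z) p = (gamma₁ z p * a) • frameX z p ∧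
    dv (frameY z) p = -((gamma₂ z p * b) • frameX z p) + (nu₂ z p * b) • unitNormal z p ∧
    du (unitNormal z) p = -((nu₁ z p * a) • frameX z p) ∧
    dv (unitNormal z) p = -((nu₂ z p * b) • frameY z p) ∧
    dv (fun q => √(-formE z q)) p = gamma₁ z p * a * b ∧
    du (fun q => √(formG z q)) p = -(gamma₂ z p * a * b) := by
  have diff : ∀ {F : Type} [NormedAddCommGroup F] [NormedSpace ℝ F] {f : ℝ × ℝ → F},
      ContDiffOn ℝ 1 f D → HasFDerivAt f (partials (du f p) (dv f p)) p := fun hf =>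
    hasFDerivAt_partials ((hf.differentiableOn (by norm_num)).differentiableAt (hD.mem_nhds hp))
  have hX := diff (h.contDiffOn_frameX hD)
  have hY := diff (h.contDiffOn_frameY hD)
  have hl := diff (h.contDiffOn_unitNormal hD)
  have hA := diff (h.contDiffOn_sqrt_neg_formE hD)
  have hB := diff (h.contDiffOn_sqrt_formG hD)
  have hfr := h.isPosOrthonormalFrame hp
  have hE := h.E_neg p hp
  have hG := h.G_pos p hp
  have ha0 : 0 < a := ha ▸ Real.sqrt_pos.2 (neg_pos.2 hE)
  have hb0 : 0 < b := hb ▸ Real.sqrt_pos.2 hG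
  have hEa : formE z p = -(a * a) := by
    rw [ha, Real.mul_self_sqrt (neg_pos.2 hE).le, neg_neg]
  have hGb : formG z p = b * b := by rw [hb, Real.mul_self_sqrt hG.le]
  -- second derivatives of the surface
  have hzu := hasFDerivAt_smul_partials hA hX
  have hzv := hasFDerivAt_smul_partials hB hY
  have zuu := (du_congr hD h.du_eq_smul hp).trans (du_eq_of_hasFDerivAt hzu)
  have zuv := (dv_congr hD h.du_eq_smul hp).trans (dv_eq_of_hasFDerivAt hzu)
  have zvu := (du_congr hD h.dv_eq_smul hp).trans (du_eq_of_hasFDerivAt hzv)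
  have zvv := (dv_congr hD h.dv_eq_smul hp).trans (dv_eq_of_hasFDerivAt hzv)
  have hsymm := dv_du_comm hD h.smooth hp
  -- Writing `E = -a²` and `G = b²` turns the definitions of `γ₁` and `γ₂` into `a_v = γ₁ab` and
  -- `b_u = -γ₂ab`.
  have hdE : dv (formE z) p = -(2 * a * dv (fun q => √(-formE z q)) p) := by
    have : EqOn (formE z) (fun q => -1 * (√(-formE z q) * √(-formE z q))) D := fun q hq => by
      simp only
      rw [Real.mul_self_sqrt (neg_pos.2 (h.E_neg q hq)).le]; ring
    rw [dv_congr hD this hp, dv_eq_of_hasFDerivAt (hasFDerivAt_mul_partials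
      (au := 0) (av := 0) (by simpa [partials] using hasFDerivAt_const (-1 : ℝ) p)
      (hasFDerivAt_mul_partials hA hA)), ha]
    ring
  have hdG : du (formG z) p = 2 * b * du (fun q => √(formG z q)) p := by
    have : EqOn (formG z) (fun q => √(formG z q) * √(formG z q)) D := fun q hq => by
      simp only
      rw [Real.mul_self_sqrt (h.G_pos q hq).le]
    rw [du_congr hD this hp, du_eq_of_hasFDerivAt (hasFDerivAt_mul_partials hB hB), hb]
    ring
  set αu := du (fun q => √(-formE z q)) p
  set αv := dv (fun q => √(-formE z q)) p
  set βu := du (fun q => √(formG z q)) p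
  set βv := dv (fun q => √(formG z q)) p
  have hαv : αv = gamma₁ z p * a * b := by
    rw [gamma₁, hdE, ← hb, hEa]
    field_simp
  have hβu : βu = -(gamma₂ z p * a * b) := by
    rw [gamma₂, hdG, ← ha, hGb]
    field_simp
  -- derivatives of the scalar products of the frame
  have hprod : ∀ {f g : ℝ × ℝ → Fin 3 → ℝ} (c : ℝ),
      HasFDerivAt f (partials (du f p) (dv f p)) p → HasFDerivAt g (partials (du g p) (dv g p)) p →
      (∀ q ∈ D, mink (f q) (g q) = c) →
      mink (f p) (du g p) = -mink (g p) (du f p) ∧ mink (f p) (dv g p) = -mink (g p) (dv f p) := by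
    intro f g c hf hg hc
    have h1 := hasFDerivAt_mink hf hg
    have h2 : HasFDerivAt (fun q => mink (f q) (g q)) (partials (0 : ℝ) 0) p := by
      have : HasFDerivAt (fun _ : ℝ × ℝ => c) (partials (0 : ℝ) 0) p := by
        simpa [partials] using hasFDerivAt_const c p
      exact this.congr_of_eventuallyEq (eventually_of_mem (hD.mem_nhds hp) hc)
    have hu := (du_eq_of_hasFDerivAt h1).symm.trans (du_eq_of_hasFDerivAt h2)
    have hv := (dv_eq_of_hasFDerivAt h1).symm.trans (dv_eq_of_hasFDerivAt h2)
    rw [mink_comm] at hu hv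
    exact ⟨by linarith, by linarith⟩
  obtain ⟨XXu, XXv⟩ := hprod _ hX hX fun q hq => (h.isPosOrthonormalFrame hq).XX
  obtain ⟨YYu, YYv⟩ := hprod _ hY hY fun q hq => (h.isPosOrthonormalFrame hq).YY
  obtain ⟨llu, llv⟩ := hprod _ hl hl fun q hq => (h.isPosOrthonormalFrame hq).ll
  obtain ⟨XYu, XYv⟩ := hprod _ hX hY fun q hq => (h.isPosOrthonormalFrame hq).XY
  obtain ⟨Xlu, Xlv⟩ := hprod _ hX hl fun q hq => (h.isPosOrthonormalFrame hq).Xl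
  obtain ⟨Ylu, Ylv⟩ := hprod _ hY hl fun q hq => (h.isPosOrthonormalFrame hq).Yl
  have hL : formL z p = -(nu₁ z p * (a * a)) := by
    rw [nu₁, hEa]; field_simp
  have hN : formN z p = nu₂ z p * (b * b) := by
    rw [nu₂, hGb]; field_simp
  have hM := h.M_zero p hp
  have hM' := hM
  rw [formL, zuu] at hL
  rw [formM, hsymm, zvu] at hM'
  rw [formM, zuv] at hM
  rw [formN, zvv] at hN
  rw [zuv, zvu] at hsymm
  -- The products `⟨X, Y_u⟩` and `⟨Y, X_v⟩` come from projecting `z_uv = z_vu`, that is `(aX)_v =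
  -- (bY)_u`, onto `X` and `Y`. The products with `l` come from `L`, `M`, `N`, where `M` is used
  -- through both `z_uv` and `z_vu`.
  have hsX := congrArg (mink (frameX z p)) hsymm
  have hsY := congrArg (mink (frameY z p)) hsymm
  have lX : mink (unitNormal z p) (frameX z p) = 0 := by rw [mink_comm, hfr.Xl]
  have lY : mink (unitNormal z p) (frameY z p) = 0 := by rw [mink_comm, hfr.Yl]
  have YX : mink (frameY z p) (frameX z p) = 0 := by rw [mink_comm, hfr.XY]
  simp only [mink_add_right, mink_smul_right, hfr.XX, hfr.YY, hfr.XY, lX, lY, YX, ← ha, ← hb] at hL hM hM' hN hsX hsY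
  rw [hαv] at hsX
  rw [hβu] at hsY
  rw [show mink (frameX z p) (dv (frameX z) p) = 0 by linarith] at hsX
  rw [show mink (frameY z p) (du (frameY z) p) = 0 by linarith] at hsY
  have ext := fun w w' => eq_of_mink_eq (w := w) (w' := w') hfr.pos.ne'
  have lXu : mink (unitNormal z p) (du (frameX z) p) = -(nu₁ z p * a) :=
    mul_left_cancel₀ ha0.ne' (by linarith)
  have lXv : mink (unitNormal z p) (dv (frameX z) p) = 0 :=
    mul_left_cancel₀ ha0.ne' (by linarith)
  have lYu : mink (unitNormal z p) (du (frameY z) p) = 0 :=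
    mul_left_cancel₀ hb0.ne' (by linarith)
  have lYv : mink (unitNormal z p) (dv (frameY z) p) = nu₂ z p * b :=
    mul_left_cancel₀ hb0.ne' (by linarith)
  have XYu' : mink (frameX z p) (du (frameY z) p) = -(gamma₁ z p * a) :=
    mul_left_cancel₀ hb0.ne' (by linarith)
  have YXv' : mink (frameY z p) (dv (frameX z) p) = -(gamma₂ z p * b) :=
    mul_left_cancel₀ ha0.ne' (by linarith)
  refine ⟨ext _ _ ?_ ?_ ?_, ext _ _ ?_ ?_ ?_, ext _ _ ?_ ?_ ?_, ext _ _ ?_ ?_ ?_,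
    ext _ _ ?_ ?_ ?_, ext _ _ ?_ ?_ ?_, hαv, hβu⟩ <;>
  simp only [mink_add_right, mink_sub_right, mink_neg_right, mink_smul_right, hfr.XX, hfr.YY,
    hfr.XY, hfr.Xl, hfr.Yl, lX, lY, YX, hfr.ll] <;> linarith

end FrameEquations

/-! ### The frame equations as a linear system and its flatness. -/

section FrameSystem

/-- The space of values of `(z, X, Y, l)`. -/
abbrev FrameSpace := Fin 4 → Fin 3 → ℝ

/-- The endomorphism of `FrameSpace` which moves the vector in place `j` to place `i`. -/
noncomputable def frameUnit (i j : Fin 4) : FrameSpace →L[ℝ] FrameSpace :=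
  (ContinuousLinearMap.single ℝ (fun _ : Fin 4 => Fin 3 → ℝ) i) ∘L ContinuousLinearMap.proj j

/-- The coefficient of `du` in the equations of the geometric frame. -/
noncomputable def frameU (c₁ c₂ c₃ : ℝ) : FrameSpace →L[ℝ] FrameSpace :=
  c₁ • frameUnit 0 1 + c₂ • frameUnit 1 2 - c₃ • frameUnit 1 3 + c₂ • frameUnit 2 1
    - c₃ • frameUnit 3 1

/-- The coefficient of `dv` in the equations of the geometric frame. -/
noncomputable def frameV (d₁ d₂ d₃ : ℝ) : FrameSpace →L[ℝ] FrameSpace :=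
  d₁ • frameUnit 0 2 - d₂ • frameUnit 1 2 - d₂ • frameUnit 2 1 + d₃ • frameUnit 2 3
    - d₃ • frameUnit 3 2

theorem frameU_apply (c₁ c₂ c₃ : ℝ) (w : FrameSpace) :
    frameU c₁ c₂ c₃ w = ![c₁ • w 1, c₂ • w 2 - c₃ • w 3, c₂ • w 1, -(c₃ • w 1)] := by
  funext i
  fin_cases i <;> simp [frameU, frameUnit]

theorem frameV_apply (d₁ d₂ d₃ : ℝ) (w : FrameSpace) :
    frameV d₁ d₂ d₃ w = ![d₁ • w 2, -(d₂ • w 2), -(d₂ • w 1) + d₃ • w 3, -(d₃ • w 2)] := by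
  funext i
  fin_cases i <;> simp [frameV, frameUnit]

/-- The differential form of the equations `dW = ω W` for `W = (z, X, Y, l)`, where
`z_u = c₁ X`, `X_u = c₂ Y - c₃ l`, `Y_u = c₂ X`, `l_u = -c₃ X` and
`z_v = d₁ Y`, `X_v = -d₂ Y`, `Y_v = -d₂ X + d₃ l`, `l_v = -d₃ Y`. -/
noncomputable def frameForm (c₁ c₂ c₃ d₁ d₂ d₃ : ℝ × ℝ → ℝ) (p : ℝ × ℝ) :
    ℝ × ℝ →L[ℝ] FrameSpace →L[ℝ] FrameSpace :=
  partials (frameU (c₁ p) (c₂ p) (c₃ p)) (frameV (d₁ p) (d₂ p) (d₃ p))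

theorem contDiffOn_partials {V : Type*} [NormedAddCommGroup V] [NormedSpace ℝ V]
    {n : WithTop ℕ∞} {f g : ℝ × ℝ → V} {D : Set (ℝ × ℝ)} (hf : ContDiffOn ℝ n f D)
    (hg : ContDiffOn ℝ n g D) : ContDiffOn ℝ n (fun p => partials (f p) (g p)) D :=
  (contDiffOn_const.smulRight hf).add (contDiffOn_const.smulRight hg)

variable {c₁ c₂ c₃ d₁ d₂ d₃ : ℝ × ℝ → ℝ} {D : Set (ℝ × ℝ)}

theorem contDiffOn_frameForm {n : WithTop ℕ∞} (hc₁ : ContDiffOn ℝ n c₁ D)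
    (hc₂ : ContDiffOn ℝ n c₂ D) (hc₃ : ContDiffOn ℝ n c₃ D) (hd₁ : ContDiffOn ℝ n d₁ D)
    (hd₂ : ContDiffOn ℝ n d₂ D) (hd₃ : ContDiffOn ℝ n d₃ D) :
    ContDiffOn ℝ n (frameForm c₁ c₂ c₃ d₁ d₂ d₃) D := by
  refine contDiffOn_partials ?_ ?_
  · exact ((((hc₁.smul contDiffOn_const).add (hc₂.smul contDiffOn_const)).sub
      (hc₃.smul contDiffOn_const)).add (hc₂.smul contDiffOn_const)).sub
      (hc₃.smul contDiffOn_const)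
  · exact ((((hd₁.smul contDiffOn_const).sub (hd₂.smul contDiffOn_const)).sub
      (hd₂.smul contDiffOn_const)).add (hd₃.smul contDiffOn_const)).sub
      (hd₃.smul contDiffOn_const)

theorem partials_flip {V W : Type*} [NormedAddCommGroup V] [NormedSpace ℝ V]
    [NormedAddCommGroup W] [NormedSpace ℝ W] (A B : V →L[ℝ] W) (w : V) :
    (partials A B).flip w = partials (A w) (B w) := by
  ext <;> simp

theorem hasFDerivAt_pi_partials {ι : Type*} [Fintype ι] {V : Type*} [NormedAddCommGroup V]
    [NormedSpace ℝ V] {f : ℝ × ℝ → ι → V} {p : ℝ × ℝ} {x y : ι → V} :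
    HasFDerivAt f (partials x y) p
      ↔ ∀ i, HasFDerivAt (fun q => f q i) (partials (x i) (y i)) p := by
  rw [hasFDerivAt_pi']
  refine forall_congr' fun i => ?_
  rw [show ContinuousLinearMap.proj i ∘L partials x y = partials (x i) (y i) by ext <;> simp]

theorem hasFDerivAt_frameForm_iff {W : ℝ × ℝ → FrameSpace} {p : ℝ × ℝ} :
    HasFDerivAt W ((frameForm c₁ c₂ c₃ d₁ d₂ d₃ p).flip (W p)) p ↔
      HasFDerivAt (fun q => W q 0) (partials (c₁ p • W p 1) (d₁ p • W p 2)) p ∧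
      HasFDerivAt (fun q => W q 1)
        (partials (c₂ p • W p 2 - c₃ p • W p 3) (-(d₂ p • W p 2))) p ∧
      HasFDerivAt (fun q => W q 2)
        (partials (c₂ p • W p 1) (-(d₂ p • W p 1) + d₃ p • W p 3)) p ∧
      HasFDerivAt (fun q => W q 3) (partials (-(c₃ p • W p 1)) (-(d₃ p • W p 2))) p := by
  rw [frameForm, partials_flip, frameU_apply, frameV_apply, hasFDerivAt_pi_partials]
  simp [Fin.forall_fin_succ]

/-- Evaluation of the form at a fixed `h` commutes with differentiation in the direction `k`, so
everything reduces to the two coefficients. -/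
theorem fderiv_partials_apply {V : Type*} [NormedAddCommGroup V] [NormedSpace ℝ V]
    {f g : ℝ × ℝ → V} {p : ℝ × ℝ} (hf : DifferentiableAt ℝ f p) (hg : DifferentiableAt ℝ g p)
    (hfg : DifferentiableAt ℝ (fun q => partials (f q) (g q)) p) (h k : ℝ × ℝ) :
    fderiv ℝ (fun q => partials (f q) (g q)) p k h
      = h.1 • (k.1 • du f p + k.2 • dv f p) + h.2 • (k.1 • du g p + k.2 • dv g p) := by
  have h1 : fderiv ℝ (fun q => partials (f q) (g q) h) p k
      = fderiv ℝ (fun q => partials (f q) (g q)) p k h := by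
    rw [fderiv_clm_apply hfg (differentiableAt_const h)]
    simp
  have h2 := ((hasFDerivAt_partials hf).const_smul h.1).add
    ((hasFDerivAt_partials hg).const_smul h.2)
  rw [← h1]
  have h3 : HasFDerivAt (fun q => partials (f q) (g q) h) _ p := h2
  rw [h3.fderiv]
  simp

theorem hasFDerivAt_frameU {p : ℝ × ℝ} {c₁u c₁v c₂u c₂v c₃u c₃v : ℝ}
    (h₁ : HasFDerivAt c₁ (partials c₁u c₁v) p) (h₂ : HasFDerivAt c₂ (partials c₂u c₂v) p)
    (h₃ : HasFDerivAt c₃ (partials c₃u c₃v) p) :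
    HasFDerivAt (fun q => frameU (c₁ q) (c₂ q) (c₃ q))
      (partials (frameU c₁u c₂u c₃u) (frameU c₁v c₂v c₃v)) p := by
  refine (((((h₁.smul_const _).add (h₂.smul_const _)).sub (h₃.smul_const _)).add
    (h₂.smul_const _)).sub (h₃.smul_const _)).congr_fderiv (ContinuousLinearMap.ext fun h => ?_)
  simp [frameU]
  module

theorem hasFDerivAt_frameV {p : ℝ × ℝ} {d₁u d₁v d₂u d₂v d₃u d₃v : ℝ}
    (h₁ : HasFDerivAt d₁ (partials d₁u d₁v) p) (h₂ : HasFDerivAt d₂ (partials d₂u d₂v) p)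
    (h₃ : HasFDerivAt d₃ (partials d₃u d₃v) p) :
    HasFDerivAt (fun q => frameV (d₁ q) (d₂ q) (d₃ q))
      (partials (frameV d₁u d₂u d₃u) (frameV d₁v d₂v d₃v)) p := by
  refine (((((h₁.smul_const _).sub (h₂.smul_const _)).sub (h₂.smul_const _)).add
    (h₃.smul_const _)).sub (h₃.smul_const _)).congr_fderiv (ContinuousLinearMap.ext fun h => ?_)
  simp [frameV]
  module

/-- The Gauss and Codazzi equations say that the form of the frame equations is flat. -/
theorem flat_frameForm {p : ℝ × ℝ} {c₁u c₁v c₂u c₂v c₃u c₃v d₁u d₁v d₂u d₂v d₃u d₃v : ℝ}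
    (hc₁ : HasFDerivAt c₁ (partials c₁u c₁v) p) (hc₂ : HasFDerivAt c₂ (partials c₂u c₂v) p)
    (hc₃ : HasFDerivAt c₃ (partials c₃u c₃v) p) (hd₁ : HasFDerivAt d₁ (partials d₁u d₁v) p)
    (hd₂ : HasFDerivAt d₂ (partials d₂u d₂v) p) (hd₃ : HasFDerivAt d₃ (partials d₃u d₃v) p)
    (hω : DifferentiableAt ℝ (frameForm c₁ c₂ c₃ d₁ d₂ d₃) p)
    (e₁ : c₁v = d₁ p * c₂ p) (e₂ : d₁u = -(c₁ p * d₂ p)) (e₃ : c₃v = c₂ p * d₃ p)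
    (e₄ : d₃u = -(d₂ p * c₃ p)) (e₅ : c₂v + d₂u = -(c₃ p * d₃ p)) (h k : ℝ × ℝ) :
    fderiv ℝ (frameForm c₁ c₂ c₃ d₁ d₂ d₃) p k h
      + frameForm c₁ c₂ c₃ d₁ d₂ d₃ p h ∘L frameForm c₁ c₂ c₃ d₁ d₂ d₃ p k
    = fderiv ℝ (frameForm c₁ c₂ c₃ d₁ d₂ d₃) p h k
      + frameForm c₁ c₂ c₃ d₁ d₂ d₃ p k ∘L frameForm c₁ c₂ c₃ d₁ d₂ d₃ p h := by
  have hU := hasFDerivAt_frameU hc₁ hc₂ hc₃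
  have hV := hasFDerivAt_frameV hd₁ hd₂ hd₃
  have hd := fun h k => fderiv_partials_apply hU.differentiableAt hV.differentiableAt hω h k
  rw [du_eq_of_hasFDerivAt hU, dv_eq_of_hasFDerivAt hU, du_eq_of_hasFDerivAt hV,
    dv_eq_of_hasFDerivAt hV] at hd
  have hd' : ∀ h k, fderiv ℝ (frameForm c₁ c₂ c₃ d₁ d₂ d₃) p k h = _ := hd
  rw [hd' h k, hd' k h]
  set U := frameU (c₁ p) (c₂ p) (c₃ p) with hUd
  set V := frameV (d₁ p) (d₂ p) (d₃ p) with hVd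
  -- The flatness defect is alternating in `h, k`, so on the plane it is a multiple of the single
  -- identity `U_v + UV = V_u + VU`.
  have key : frameU c₁v c₂v c₃v + U ∘L V = frameV d₁u d₂u d₃u + V ∘L U := by
    refine ContinuousLinearMap.ext fun w => ?_
    have e₅' : c₂v = -(c₃ p * d₃ p) - d₂u := by linarith
    funext i
    simp only [hUd, hVd, add_apply, ContinuousLinearMap.comp_apply, frameU_apply, frameV_apply,
      e₁, e₂, e₃, e₄, e₅']
    fin_cases i <;> simp <;> module
  have hf : ∀ h, frameForm c₁ c₂ c₃ d₁ d₂ d₃ p h = h.1 • U + h.2 • V := fun h => rfl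
  simp only [hf, ContinuousLinearMap.comp_add, ContinuousLinearMap.add_comp,
    ContinuousLinearMap.comp_smul, ContinuousLinearMap.smul_comp]
  linear_combination (norm := module) (h.1 * k.2 - h.2 * k.1) • key

end FrameSystem

/-! ### Uniqueness. -/

section Uniqueness

variable {ν₁ ν₂ γ₁ γ₂ : ℝ × ℝ → ℝ} {p₀ : ℝ × ℝ} {z₀ X₀ Y₀ l₀ : Fin 3 → ℝ}
  {z : ℝ × ℝ → Fin 3 → ℝ} {D : Set (ℝ × ℝ)}

/-- The functions `a`, `b` are free up to agreement on `D`, so that the systems of two surfaces can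
be written with literally the same coefficients. -/
theorem IsSolution.frame_equations (h : IsSolution ν₁ ν₂ γ₁ γ₂ p₀ z₀ X₀ Y₀ l₀ z D) (hD : IsOpen D)
    {p : ℝ × ℝ} (hp : p ∈ D) {a b : ℝ × ℝ → ℝ} (ha : ∀ q ∈ D, √(-formE z q) = a q)
    (hb : ∀ q ∈ D, √(formG z q) = b q) :
    HasFDerivAt z (partials (a p • frameX z p) (b p • frameY z p)) p ∧
    HasFDerivAt (frameX z) (partials ((γ₁ p * a p) • frameY z p - (ν₁ p * a p) • unitNormal z p)
      (-((γ₂ p * b p) • frameY z p))) p ∧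
    HasFDerivAt (frameY z) (partials ((γ₁ p * a p) • frameX z p)
      (-((γ₂ p * b p) • frameX z p) + (ν₂ p * b p) • unitNormal z p)) p ∧
    HasFDerivAt (unitNormal z) (partials (-((ν₁ p * a p) • frameX z p))
      (-((ν₂ p * b p) • frameY z p))) p := by
  have hr := h.stronglyRegular
  have diff : ∀ {f : ℝ × ℝ → Fin 3 → ℝ},
      ContDiffOn ℝ 1 f D → HasFDerivAt f (partials (du f p) (dv f p)) p := fun hf =>
    hasFDerivAt_partials ((hf.differentiableOn (by norm_num)).differentiableAt (hD.mem_nhds hp))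
  have hz := diff (hr.smooth.of_le (by norm_num))
  have hX := diff (hr.contDiffOn_frameX hD)
  have hY := diff (hr.contDiffOn_frameY hD)
  have hl := diff (hr.contDiffOn_unitNormal hD)
  obtain ⟨e1, e2, e3, e4, e5, e6, -, -⟩ :=
    hr.frame_equations hD hp (ha p hp).symm (hb p hp).symm
  rw [h.nu₁_eq p hp, h.gamma₁_eq p hp] at e1
  rw [h.gamma₂_eq p hp] at e2 e4
  rw [h.gamma₁_eq p hp] at e3
  rw [h.nu₂_eq p hp] at e4 e6
  rw [h.nu₁_eq p hp] at e5
  rw [e1, e2] at hX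
  rw [e3, e4] at hY
  rw [e5, e6] at hl
  rw [hr.du_eq_smul hp, hr.dv_eq_smul hp] at hz
  simp only [ha p hp, hb p hp] at hz
  exact ⟨hz, hX, hY, hl⟩

/-- The Codazzi equations determine `√(-E)` and `√G` by the invariants. -/
theorem IsSolution.codazzi (h : IsSolution ν₁ ν₂ γ₁ γ₂ p₀ z₀ X₀ Y₀ l₀ z D) (hD : IsOpen D)
    (hν₁ : ContDiffOn ℝ 1 ν₁ D) (hν₂ : ContDiffOn ℝ 1 ν₂ D) {p : ℝ × ℝ} (hp : p ∈ D) :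
    √(-formE z p) * ((ν₁ p - ν₂ p) * γ₂ p) = -du ν₂ p ∧
    √(formG z p) * ((ν₁ p - ν₂ p) * γ₁ p) = -dv ν₁ p := by
  have hr := h.stronglyRegular
  set a : ℝ × ℝ → ℝ := fun q => √(-formE z q) with had
  set b : ℝ × ℝ → ℝ := fun q => √(formG z q) with hbd
  have hfr := fun q (hq : q ∈ D) =>
    h.frame_equations hD hq (a := a) (b := b) (fun _ _ => rfl) (fun _ _ => rfl)
  have hac := hr.contDiffOn_sqrt_neg_formE hD
  have hbc := hr.contDiffOn_sqrt_formG hD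
  have hXc := hr.contDiffOn_frameX hD
  have hYc := hr.contDiffOn_frameY hD
  -- Here the normal is better than the surface suggests: its partial derivatives are products of
  -- `C¹` functions by the frame equations.
  have hl2 : ContDiffOn ℝ 2 (unitNormal z) D := by
    rw [show (2 : WithTop ℕ∞) = 1 + 1 by norm_num, contDiffOn_succ_iff_fderiv_of_isOpen hD]
    refine ⟨(hr.contDiffOn_unitNormal hD).differentiableOn (by norm_num), by simp, ?_⟩
    exact (contDiffOn_partials ((hν₁.mul hac).smul hXc).neg ((hν₂.mul hbc).smul hYc).neg).congr
      fun q hq => (hfr q hq).2.2.2.fderiv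
  have diff : ∀ {f : ℝ × ℝ → ℝ},
      ContDiffOn ℝ 1 f D → HasFDerivAt f (partials (du f p) (dv f p)) p := fun hf =>
    hasFDerivAt_partials ((hf.differentiableOn (by norm_num)).differentiableAt (hD.mem_nhds hp))
  obtain ⟨-, hX, hY, -⟩ := hfr p hp
  have h1 := (hasFDerivAt_smul_partials (hasFDerivAt_mul_partials (diff hν₁) (diff hac)) hX)
  have h2 := (hasFDerivAt_smul_partials (hasFDerivAt_mul_partials (diff hν₂) (diff hbc)) hY)
  have hsymm := dv_du_comm hD hl2 hp
  rw [dv_congr hD (fun q hq => du_eq_of_hasFDerivAt (hfr q hq).2.2.2) hp,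
    du_congr hD (fun q hq => dv_eq_of_hasFDerivAt (hfr q hq).2.2.2) hp] at hsymm
  have hneg : ∀ f : ℝ × ℝ → Fin 3 → ℝ, du (fun q => -f q) p = -du f p ∧
      dv (fun q => -f q) p = -dv f p := fun f => by
    simp [du, dv, fderiv_fun_neg]
  rw [(hneg _).1, (hneg _).2, neg_inj, dv_eq_of_hasFDerivAt h1, du_eq_of_hasFDerivAt h2] at hsymm
  obtain ⟨-, -, -, -, -, -, hav, hbu⟩ := hr.frame_equations hD hp (a := a p) (b := b p) rfl rfl
  rw [h.gamma₁_eq p hp] at hav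
  rw [h.gamma₂_eq p hp] at hbu
  have hav' : dv a p = γ₁ p * a p * b p := hav
  have hbu' : du b p = -(γ₂ p * a p * b p) := hbu
  change (dv ν₁ p * a p + ν₁ p * dv a p) • _ + _ = (du ν₂ p * b p + ν₂ p * du b p) • _ + _ at hsymm
  rw [hav', hbu'] at hsymm
  have hf := hr.isPosOrthonormalFrame hp
  -- The `Y` component of `l_uv = l_vu` gives the equation for `a` after cancelling `b`; the `X`
  -- component gives the one for `b` after cancelling `a`.
  have hsX := congrArg (mink (frameX z p)) hsymm
  have hsY := congrArg (mink (frameY z p)) hsymm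
  have YX : mink (frameY z p) (frameX z p) = 0 := by rw [mink_comm, hf.XY]
  simp only [mink_add_right, mink_neg_right, mink_smul_right, hf.XX, hf.YY, hf.XY,
    YX] at hsX hsY
  have ha0 : 0 < a p := Real.sqrt_pos.2 (neg_pos.2 (hr.E_neg p hp))
  have hb0 : 0 < b p := Real.sqrt_pos.2 (hr.G_pos p hp)
  constructor
  · exact mul_left_cancel₀ hb0.ne' (by linear_combination -hsY)
  · exact mul_left_cancel₀ ha0.ne' (by linear_combination -hsX)

/-- By strong regularity the factors of `a` and `b` in the Codazzi equations can be cancelled, so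
both frames solve one system with continuous coefficients and the same initial value. -/
theorem IsSolution.eqOn (hD : IsOpen D) (hDc : IsPreconnected D) (hp₀ : p₀ ∈ D)
    (hν₁ : ContDiffOn ℝ 1 ν₁ D) (hν₂ : ContDiffOn ℝ 1 ν₂ D) (hγ₁ : ContinuousOn γ₁ D)
    (hγ₂ : ContinuousOn γ₂ D) {z' : ℝ × ℝ → Fin 3 → ℝ}
    (h : IsSolution ν₁ ν₂ γ₁ γ₂ p₀ z₀ X₀ Y₀ l₀ z D)
    (h' : IsSolution ν₁ ν₂ γ₁ γ₂ p₀ z₀ X₀ Y₀ l₀ z' D) : EqOn z z' D := by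
  have hr := h.stronglyRegular
  have hne : ∀ p ∈ D, (ν₁ p - ν₂ p) * γ₁ p ≠ 0 ∧ (ν₁ p - ν₂ p) * γ₂ p ≠ 0 := by
    intro p hp
    have := hr.regular p hp
    rw [h.nu₁_eq p hp, h.nu₂_eq p hp, h.gamma₁_eq p hp, h.gamma₂_eq p hp] at this
    simp only [mul_ne_zero_iff] at this ⊢
    tauto
  set a : ℝ × ℝ → ℝ := fun q => √(-formE z q) with had
  set b : ℝ × ℝ → ℝ := fun q => √(formG z q) with hbd
  have ha' : ∀ p ∈ D, √(-formE z' p) = a p := fun p hp =>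
    mul_right_cancel₀ (hne p hp).2
      ((h'.codazzi hD hν₁ hν₂ hp).1.trans (h.codazzi hD hν₁ hν₂ hp).1.symm)
  have hb' : ∀ p ∈ D, √(formG z' p) = b p := fun p hp =>
    mul_right_cancel₀ (hne p hp).1
      ((h'.codazzi hD hν₁ hν₂ hp).2.trans (h.codazzi hD hν₁ hν₂ hp).2.symm)
  have hac : ContDiffOn ℝ 0 a D := (hr.contDiffOn_sqrt_neg_formE hD).of_le (by norm_num)
  have hbc : ContDiffOn ℝ 0 b D := (hr.contDiffOn_sqrt_formG hD).of_le (by norm_num)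
  have hω := contDiffOn_frameForm hac ((contDiffOn_zero.2 hγ₁).mul hac)
    ((hν₁.of_le (by norm_num)).mul hac) hbc ((contDiffOn_zero.2 hγ₂).mul hbc)
    ((hν₂.of_le (by norm_num)).mul hbc)
  have := eqOn_of_hasFDerivAt_flip hD hDc hω.continuousOn
    (W := fun q => ![z q, frameX z q, frameY z q, unitNormal z q])
    (W' := fun q => ![z' q, frameX z' q, frameY z' q, unitNormal z' q])
    (fun p hp => hasFDerivAt_frameForm_iff.2
      (h.frame_equations hD hp (fun _ _ => rfl) (fun _ _ => rfl)))
    (fun p hp => hasFDerivAt_frameForm_iff.2 (h'.frame_equations hD hp ha' hb')) hp₀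
    (by simp only [h.z_init, h.X_init, h.Y_init, h.l_init, h'.z_init, h'.X_init, h'.Y_init,
          h'.l_init])
  intro p hp
  exact congrFun (this hp) 0

end Uniqueness

/-! ### Orthonormality of the frame. -/

section Gram

/-- With `M` the matrix of rows `X, Y, l`, the two sides read `M J Mᵀ = J'` and `Mᵀ J' M = J`; they
agree because `J² = J'² = 1` and a one-sided inverse of a square matrix is two-sided. The second
form is preferred since the frame equations make its entries constant outright, whereas the scalar
products satisfy a coupled linear system. -/
theorem gram_eq_iff {X Y l : Fin 3 → ℝ} :
    (mink X X = -1 ∧ mink Y Y = 1 ∧ mink l l = 1 ∧ mink X Y = 0 ∧ mink X l = 0 ∧ mink Y l = 0) ↔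
      ∀ i j, -(X i * X j) + Y i * Y j + l i * l j
        = Matrix.diagonal ![(1 : ℝ), 1, -1] i j := by
  let M : Matrix (Fin 3) (Fin 3) ℝ := Matrix.of ![X, Y, l]
  let J : Matrix (Fin 3) (Fin 3) ℝ := Matrix.diagonal ![1, 1, -1]
  let J' : Matrix (Fin 3) (Fin 3) ℝ := Matrix.diagonal ![-1, 1, 1]
  have hJ : J * J = 1 := by
    ext i j; fin_cases i <;> fin_cases j <;> simp [J]
  have hJ' : J' * J' = 1 := by
    ext i j; fin_cases i <;> fin_cases j <;> simp [J']
  have h1 : (mink X X = -1 ∧ mink Y Y = 1 ∧ mink l l = 1 ∧ mink X Y = 0 ∧ mink X l = 0 ∧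
      mink Y l = 0) ↔ M * J * M.transpose = J' := by
    rw [← Matrix.ext_iff]
    simp only [Fin.forall_fin_succ, Matrix.mul_apply, Fin.sum_univ_three, M, J, J', mink]
    simp
    constructor
    · rintro ⟨h1, h2, h3, h4, h5, h6⟩
      refine ⟨⟨?_, ?_, ?_⟩, ⟨?_, ?_, ?_⟩, ?_, ?_, ?_⟩ <;> linarith
    · rintro ⟨⟨h1, h2, h3⟩, ⟨-, h4, h5⟩, -, -, h6⟩
      refine ⟨?_, ?_, ?_, ?_, ?_, ?_⟩ <;> linarith
  have h2 : (∀ i j, -(X i * X j) + Y i * Y j + l i * l j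
      = Matrix.diagonal ![(1 : ℝ), 1, -1] i j) ↔ M.transpose * J' * M = J := by
    rw [← Matrix.ext_iff]
    refine forall_congr' fun i => forall_congr' fun j => ?_
    simp only [Matrix.mul_apply, Fin.sum_univ_three, M, J, J']
    simp
  rw [h1, h2]
  constructor
  · intro h
    have : M * (J * M.transpose * J') = 1 := by
      rw [← hJ', ← h]; simp only [Matrix.mul_assoc]
    rw [mul_eq_one_comm] at this
    calc M.transpose * J' * M = J * J * (M.transpose * J' * M) := by rw [hJ, one_mul]
      _ = J * (J * M.transpose * J' * M) := by simp only [Matrix.mul_assoc]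
      _ = J := by rw [this, mul_one]
  · intro h
    have : J * M.transpose * J' * M = 1 := by
      rw [← hJ, ← h]; simp only [Matrix.mul_assoc]
    rw [mul_eq_one_comm] at this
    calc M * J * M.transpose = M * J * M.transpose * (J' * J') := by rw [hJ', mul_one]
      _ = M * (J * M.transpose * J') * J' := by simp only [Matrix.mul_assoc]
      _ = J' := by rw [this, one_mul]

/-- The equations of the frame preserve orthonormality. -/
theorem gram_const {X Y l : ℝ × ℝ → Fin 3 → ℝ} {D : Set (ℝ × ℝ)} (hD : IsOpen D)
    (hDc : IsPreconnected D) {c₂ c₃ d₂ d₃ : ℝ × ℝ → ℝ}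
    (hX : ∀ p ∈ D, HasFDerivAt X (partials (c₂ p • Y p - c₃ p • l p) (-(d₂ p • Y p))) p)
    (hY : ∀ p ∈ D, HasFDerivAt Y (partials (c₂ p • X p) (-(d₂ p • X p) + d₃ p • l p)) p)
    (hl : ∀ p ∈ D, HasFDerivAt l (partials (-(c₃ p • X p)) (-(d₃ p • Y p))) p)
    {p₀ p : ℝ × ℝ} (hp₀ : p₀ ∈ D) (hp : p ∈ D) (i j : Fin 3) :
    -(X p i * X p j) + Y p i * Y p j + l p i * l p j
      = -(X p₀ i * X p₀ j) + Y p₀ i * Y p₀ j + l p₀ i * l p₀ j := by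
  have hd : ∀ q ∈ D, HasFDerivAt
      (fun p => -(X p i * X p j) + Y p i * Y p j + l p i * l p j) (0 : ℝ × ℝ →L[ℝ] ℝ) q := by
    intro q hq
    have hX' := hasFDerivAt_pi_partials.1 (hX q hq)
    have hY' := hasFDerivAt_pi_partials.1 (hY q hq)
    have hl' := hasFDerivAt_pi_partials.1 (hl q hq)
    refine (((hasFDerivAt_mul_partials (hX' i) (hX' j)).neg.add
      (hasFDerivAt_mul_partials (hY' i) (hY' j))).add
      (hasFDerivAt_mul_partials (hl' i) (hl' j))).congr_fderiv (ContinuousLinearMap.ext fun h => ?_)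
    simp
    ring
  exact hD.is_const_of_fderiv_eq_zero hDc
    (fun q hq => (hd q hq).differentiableAt.differentiableWithinAt)
    (fun q hq => (hd q hq).fderiv) hp hp₀

end Gram

/-! ### Existence. -/

section Existence

/-- A solution of the equations of the frame with orthonormal values is a surface in principal
parameters with the expected invariants. -/
theorem isSolution_of_frame {ν₁ ν₂ γ₁ γ₂ a b : ℝ × ℝ → ℝ} {D : Set (ℝ × ℝ)} (hD : IsOpen D)
    (hreg : ∀ p ∈ D, (ν₁ p - ν₂ p) * γ₁ p * γ₂ p ≠ 0)
    (ha : ∀ p ∈ D, 0 < a p) (hb : ∀ p ∈ D, 0 < b p)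
    (hac : DifferentiableOn ℝ a D) (hbc : DifferentiableOn ℝ b D)
    (hav : ∀ p ∈ D, dv a p = γ₁ p * a p * b p)
    (hbu : ∀ p ∈ D, du b p = -(γ₂ p * a p * b p))
    {z X Y l : ℝ × ℝ → Fin 3 → ℝ} (hsm : ContDiffOn ℝ 2 z D)
    (hz : ∀ p ∈ D, HasFDerivAt z (partials (a p • X p) (b p • Y p)) p)
    (hX : ∀ p ∈ D, HasFDerivAt X
      (partials ((γ₁ p * a p) • Y p - (ν₁ p * a p) • l p) (-((γ₂ p * b p) • Y p))) p)
    (hY : ∀ p ∈ D, HasFDerivAt Y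
      (partials ((γ₁ p * a p) • X p) (-((γ₂ p * b p) • X p) + (ν₂ p * b p) • l p)) p)
    (hf : ∀ p ∈ D, IsPosOrthonormalFrame (X p) (Y p) (l p)) {p₀ : ℝ × ℝ} (hp₀ : p₀ ∈ D) :
    IsSolution ν₁ ν₂ γ₁ γ₂ p₀ (z p₀) (X p₀) (Y p₀) (l p₀) z D := by
  have zu : EqOn (du z) (fun p => a p • X p) D := fun p hp => du_eq_of_hasFDerivAt (hz p hp)
  have zv : EqOn (dv z) (fun p => b p • Y p) D := fun p hp => dv_eq_of_hasFDerivAt (hz p hp)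
  have hE : EqOn (formE z) (fun p => -1 * (a p * a p)) D := fun p hp => by
    simp only [formE, zu hp, mink_smul_left, mink_smul_right, (hf p hp).XX]; ring
  have hF : EqOn (formF z) 0 D := fun p hp => by
    simp only [formF, zu hp, zv hp, mink_smul_left, mink_smul_right, (hf p hp).XY]; simp
  have hG : EqOn (formG z) (fun p => b p * b p) D := fun p hp => by
    simp only [formG, zv hp, mink_smul_left, mink_smul_right, (hf p hp).YY]; ring
  have hE0 : ∀ p ∈ D, formE z p < 0 := fun p hp => by
    rw [hE hp]; nlinarith [ha p hp]
  have hG0 : ∀ p ∈ D, 0 < formG z p := fun p hp => by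
    rw [hG hp]; nlinarith [hb p hp]
  have hsE : ∀ p ∈ D, √(-formE z p) = a p := fun p hp => by
    rw [hE hp]
    simp only [neg_mul, one_mul, neg_neg]
    exact Real.sqrt_mul_self (ha p hp).le
  have hsG : ∀ p ∈ D, √(formG z p) = b p := fun p hp => by
    rw [hG hp]
    exact Real.sqrt_mul_self (hb p hp).le
  have hfX : ∀ p ∈ D, frameX z p = X p := fun p hp => by
    rw [frameX, hsE p hp, zu hp, inv_smul_smul₀ (ha p hp).ne']
  have hfY : ∀ p ∈ D, frameY z p = Y p := fun p hp => by
    rw [frameY, hsG p hp, zv hp, inv_smul_smul₀ (hb p hp).ne']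
  have hfl : ∀ p ∈ D, unitNormal z p = l p := fun p hp => by
    refine (unitNormal_unique z p (l p) ?_ ?_ ?_ (hf p hp).ll ?_).symm
    · have h1 := hE0 p hp
      have h2 := hG0 p hp
      rw [hF hp]
      simp only [Pi.zero_apply]
      nlinarith
    · rw [zu hp, mink_smul_left, (hf p hp).Xl, mul_zero]
    · rw [zv hp, mink_smul_left, (hf p hp).Yl, mul_zero]
    · rw [zu hp, zv hp, ← one_smul ℝ (l p), vol_smul]
      have := (hf p hp).pos
      have := ha p hp
      have := hb p hp
      positivity
  have hA := fun p (hp : p ∈ D) => hasFDerivAt_partials (hac.differentiableAt (hD.mem_nhds hp))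
  have hB := fun p (hp : p ∈ D) => hasFDerivAt_partials (hbc.differentiableAt (hD.mem_nhds hp))
  have lX : ∀ p ∈ D, mink (l p) (X p) = 0 := fun p hp => by rw [mink_comm, (hf p hp).Xl]
  have lY : ∀ p ∈ D, mink (l p) (Y p) = 0 := fun p hp => by rw [mink_comm, (hf p hp).Yl]
  -- In the derivatives of `z_u = aX` and `z_v = bY` the terms with derivatives of `a` and `b` are
  -- tangent, so the product with `l` kills them.
  have hL : ∀ p ∈ D, formL z p = -(ν₁ p * (a p * a p)) := fun p hp => by
    rw [formL, hfl p hp, du_congr hD zu hp,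
      du_eq_of_hasFDerivAt (hasFDerivAt_smul_partials (hA p hp) (hX p hp))]
    simp only [mink_add_right, mink_sub_right, mink_smul_right, lX p hp, lY p hp, (hf p hp).ll]
    ring
  have hM : ∀ p ∈ D, formM z p = 0 := fun p hp => by
    rw [formM, hfl p hp, dv_congr hD zu hp,
      dv_eq_of_hasFDerivAt (hasFDerivAt_smul_partials (hA p hp) (hX p hp))]
    simp only [mink_add_right, mink_neg_right, mink_smul_right, lX p hp, lY p hp]
    ring
  have hN : ∀ p ∈ D, formN z p = ν₂ p * (b p * b p) := fun p hp => by
    rw [formN, hfl p hp, dv_congr hD zv hp,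
      dv_eq_of_hasFDerivAt (hasFDerivAt_smul_partials (hB p hp) (hY p hp))]
    simp only [mink_add_right, mink_neg_right, mink_smul_right, lX p hp, lY p hp, (hf p hp).ll]
    ring
  have hnu₁ : ∀ p ∈ D, nu₁ z p = ν₁ p := fun p hp => by
    have := (ha p hp).ne'
    rw [nu₁, hL p hp, hE hp]
    field_simp
  have hnu₂ : ∀ p ∈ D, nu₂ z p = ν₂ p := fun p hp => by
    have := (hb p hp).ne'
    rw [nu₂, hN p hp, hG hp]
    field_simp
  have hga₁ : ∀ p ∈ D, gamma₁ z p = γ₁ p := fun p hp => by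
    have := (ha p hp).ne'
    have := (hb p hp).ne'
    rw [gamma₁, hsG p hp, dv_congr hD hE hp, dv_eq_of_hasFDerivAt (hasFDerivAt_mul_partials
      (au := 0) (av := 0) (by simpa [partials] using hasFDerivAt_const (-1 : ℝ) p)
      (hasFDerivAt_mul_partials (hA p hp) (hA p hp))), hE hp, hav p hp]
    field_simp
    ring
  have hga₂ : ∀ p ∈ D, gamma₂ z p = γ₂ p := fun p hp => by
    have := (ha p hp).ne'
    have := (hb p hp).ne'
    rw [gamma₂, hsE p hp, du_congr hD hG hp, du_eq_of_hasFDerivAt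
      (hasFDerivAt_mul_partials (hB p hp) (hB p hp)), hG hp, hbu p hp]
    field_simp
    ring
  refine ⟨⟨hsm, hE0, hG0, hF, hM, fun p hp => ?_⟩, hnu₁, hnu₂, hga₁, hga₂, rfl, hfX _ hp₀,
    hfY _ hp₀, hfl _ hp₀⟩
  rw [hnu₁ p hp, hnu₂ p hp, hga₁ p hp, hga₂ p hp]
  exact hreg p hp

/-- If `(ln |f|)' = r` in some direction, then `f' = r f`. -/
theorem fderiv_eq_of_fderiv_log_abs {f : ℝ × ℝ → ℝ} {p h : ℝ × ℝ} {r : ℝ}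
    (hf : DifferentiableAt ℝ f p) (h0 : f p ≠ 0)
    (hr : fderiv ℝ (fun q => Real.log |f q|) p h = r) : fderiv ℝ f p h = r * f p := by
  -- `Real.log` is already even, so the absolute value can be dropped for either sign of `f`.
  simp only [Real.log_abs] at hr
  rw [fderiv.log hf h0] at hr
  rw [← hr]
  simp
  field_simp

theorem fderiv_neg_div {g d : ℝ × ℝ → ℝ} {p h : ℝ × ℝ} (hg : DifferentiableAt ℝ g p)
    (hd : DifferentiableAt ℝ d p) (h0 : d p ≠ 0) :
    fderiv ℝ (fun q => -g q / d q) p h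
      = (g p * fderiv ℝ d p h - fderiv ℝ g p h * d p) / d p ^ 2 := by
  have := hg.hasFDerivAt.neg.mul ((hasDerivAt_inv h0).comp_hasFDerivAt p hd.hasFDerivAt)
  rw [show (fun q => -g q / d q) = -g * (fun y => y⁻¹) ∘ d from funext fun q => div_eq_mul_inv _ _,
    this.fderiv]
  simp
  field_simp
  ring

/-- The Gauss and Codazzi equations guarantee the local existence of a surface in principal
parameters with given invariants. -/
theorem exists_isSolution {n : ℕ∞} (hn : 1 ≤ n) {D : Set (ℝ × ℝ)} (hD : IsOpen D)
    {p₀ : ℝ × ℝ} (hp₀ : p₀ ∈ D) {ν₁ ν₂ γ₁ γ₂ a b : ℝ × ℝ → ℝ}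
    (hν₁ : ContDiffOn ℝ n ν₁ D) (hν₂ : ContDiffOn ℝ n ν₂ D)
    (hγ₁ : ContDiffOn ℝ n γ₁ D) (hγ₂ : ContDiffOn ℝ n γ₂ D)
    (hac : ContDiffOn ℝ n a D) (hbc : ContDiffOn ℝ n b D)
    (hreg : ∀ p ∈ D, (ν₁ p - ν₂ p) * γ₁ p * γ₂ p ≠ 0)
    (ha : ∀ p ∈ D, 0 < a p) (hb : ∀ p ∈ D, 0 < b p)
    (hav : ∀ p ∈ D, dv a p = γ₁ p * a p * b p)
    (hbu : ∀ p ∈ D, du b p = -(γ₂ p * a p * b p))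
    (hνv : ∀ p ∈ D, dv ν₁ p = -((ν₁ p - ν₂ p) * γ₁ p * b p))
    (hνu : ∀ p ∈ D, du ν₂ p = -((ν₁ p - ν₂ p) * γ₂ p * a p))
    (gauss : ∀ p ∈ D, dv γ₁ p * a p + du γ₂ p * b p + (γ₁ p ^ 2 - γ₂ p ^ 2) * a p * b p
      = -(ν₁ p * ν₂ p * a p * b p))
    (z₀ : Fin 3 → ℝ) {X₀ Y₀ l₀ : Fin 3 → ℝ} (hframe : IsPosOrthonormalFrame X₀ Y₀ l₀) :
    ∃ D₀ : Set (ℝ × ℝ), IsOpen D₀ ∧ IsConnected D₀ ∧ p₀ ∈ D₀ ∧ D₀ ⊆ D ∧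
      ∃ z : ℝ × ℝ → (Fin 3 → ℝ), ContDiffOn ℝ ((n : WithTop ℕ∞) + 1) z D₀ ∧
        IsSolution ν₁ ν₂ γ₁ γ₂ p₀ z₀ X₀ Y₀ l₀ z D₀ := by
  have h1n : (1 : WithTop ℕ∞) ≤ n := by exact_mod_cast hn
  have hω := contDiffOn_frameForm hac (hγ₁.mul hac) (hν₁.mul hac) hbc (hγ₂.mul hbc) (hν₂.mul hbc)
  have flat : ∀ p ∈ D, _ := fun p hp => by
    have diff : ∀ {f : ℝ × ℝ → ℝ},
        ContDiffOn ℝ n f D → HasFDerivAt f (partials (du f p) (dv f p)) p := fun hf =>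
      hasFDerivAt_partials (((hf.of_le h1n).differentiableOn
        (by norm_num)).differentiableAt (hD.mem_nhds hp))
    exact flat_frameForm (diff hac) (hasFDerivAt_mul_partials (diff hγ₁) (diff hac))
      (hasFDerivAt_mul_partials (diff hν₁) (diff hac)) (diff hbc)
      (hasFDerivAt_mul_partials (diff hγ₂) (diff hbc))
      (hasFDerivAt_mul_partials (diff hν₂) (diff hbc))
      (((hω.of_le h1n).differentiableOn (by norm_num)).differentiableAt (hD.mem_nhds hp))
      (by rw [hav p hp]; ring)
      (by rw [hbu p hp]; ring)
      (by rw [hav p hp, hνv p hp]; ring)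
      (by rw [hbu p hp, hνu p hp]; ring)
      (by rw [hav p hp, hbu p hp]; linear_combination gauss p hp)
  obtain ⟨r, hr, hrD, W, hW0, hW⟩ :=
    exists_hasFDerivAt_of_flat hD (hω.of_le h1n) flat hp₀ ![z₀, X₀, Y₀, l₀]
  have hWs := contDiffOn_pi.1 (contDiffOn_succ_of_hasFDerivAt_flip isOpen_ball (hω.mono hrD) hW)
  have hWf := fun p hp => hasFDerivAt_frameForm_iff.1 (hW p hp)
  have h0 : W p₀ 0 = z₀ := by simp [hW0]
  have h1 : W p₀ 1 = X₀ := by simp [hW0]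
  have h2 : W p₀ 2 = Y₀ := by simp [hW0]
  have h3 : W p₀ 3 = l₀ := by simp [hW0]
  have hWc : ContinuousAt W p₀ := (hW p₀ (mem_ball_self hr)).continuousAt
  have hvol : ContinuousAt (fun p => vol (W p 1) (W p 2) (W p 3)) p₀ := by
    have hc : ∀ i j, ContinuousAt (fun p => W p i j) p₀ := fun i j =>
      continuousAt_pi.1 (continuousAt_pi.1 hWc i) j
    simp only [vol, Matrix.det_fin_three]
    simp only [Matrix.of_apply, Matrix.cons_val]
    fun_prop
  -- The Gram relations do not see the orientation; its positivity is an open condition, secured by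
  -- shrinking the ball.
  have hvol0 : ∀ᶠ p in 𝓝 p₀, 0 < vol (W p 1) (W p 2) (W p 3) :=
    hvol.eventually_const_lt (by simp only [h1, h2, h3]; exact hframe.pos)
  obtain ⟨s, hs, hsv⟩ := Metric.mem_nhds_iff.1 hvol0
  set ρ := min r s
  have hρ : 0 < ρ := lt_min hr hs
  have hρr : ball p₀ ρ ⊆ ball p₀ r := ball_subset_ball (min_le_left _ _)
  have hρD : ball p₀ ρ ⊆ D := hρr.trans hrD
  have hgram := fun p (hp : p ∈ ball p₀ ρ) => gram_const (X := fun p => W p 1)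
    (Y := fun p => W p 2) (l := fun p => W p 3) isOpen_ball (convex_ball p₀ ρ).isPreconnected
    (fun q hq => (hWf q (hρr hq)).2.1) (fun q hq => (hWf q (hρr hq)).2.2.1)
    (fun q hq => (hWf q (hρr hq)).2.2.2) (mem_ball_self hρ) hp
  have hon : ∀ p ∈ ball p₀ ρ, IsPosOrthonormalFrame (W p 1) (W p 2) (W p 3) := by
    intro p hp
    obtain ⟨e1, e2, e3, e4, e5, e6⟩ := gram_eq_iff.2 fun i j => (hgram p hp i j).trans (by
      simp only [h1, h2, h3]
      exact gram_eq_iff.1 ⟨hframe.XX, hframe.YY, hframe.ll, hframe.XY, hframe.Xl, hframe.Yl⟩ i j)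
    exact ⟨e1, e2, e3, e4, e5, e6, hsv (ball_subset_ball (min_le_right _ _) hp)⟩
  have hzs : ContDiffOn ℝ ((n : WithTop ℕ∞) + 1) (fun p => W p 0) (ball p₀ ρ) :=
    (hWs 0).mono hρr
  refine ⟨ball p₀ ρ, isOpen_ball, (convex_ball p₀ ρ).isConnected ⟨p₀, mem_ball_self hρ⟩,
    mem_ball_self hρ, hρD, fun p => W p 0, hzs, ?_⟩
  have := isSolution_of_frame isOpen_ball (fun p hp => hreg p (hρD hp)) (fun p hp => ha p (hρD hp))
    (fun p hp => hb p (hρD hp)) (((hac.of_le h1n).differentiableOn (by norm_num)).mono hρD)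
    (((hbc.of_le h1n).differentiableOn (by norm_num)).mono hρD) (fun p hp => hav p (hρD hp))
    (fun p hp => hbu p (hρD hp))
    (hzs.of_le (by
      rw [show (2 : WithTop ℕ∞) = 1 + 1 by norm_num]
      exact add_le_add_left h1n 1))
    (fun p hp => (hWf p (hρr hp)).1) (fun p hp => (hWf p (hρr hp)).2.1)
    (fun p hp => (hWf p (hρr hp)).2.2.1) hon (mem_ball_self hρ)
  simpa only [h0, h1, h2, h3] using this

end Existence

end TimelikeSurface

/-! ### The theorem: recovering `a` and `b` from the invariants. -/

theorem theorem2p1 (n : ℕ∞) (hn : 1 ≤ n) (u₀ v₀ : ℝ) (D : Set (ℝ × ℝ)) (hD : IsOpen D)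
    (h₀ : (u₀, v₀) ∈ D) (ν₁ ν₂ γ₁ γ₂ : ℝ × ℝ → ℝ)
    (hν₁ : ContDiffOn ℝ ((n : WithTop ℕ∞) + 1) ν₁ D)
    (hν₂ : ContDiffOn ℝ ((n : WithTop ℕ∞) + 1) ν₂ D)
    (hγ₁ : ContDiffOn ℝ (n : WithTop ℕ∞) γ₁ D)
    (hγ₂ : ContDiffOn ℝ (n : WithTop ℕ∞) γ₂ D)
    (sign₁ : ∀ p ∈ D, (ν₁ p - ν₂ p) * γ₁ p * dv ν₁ p < 0)
    (sign₂ : ∀ p ∈ D, (ν₁ p - ν₂ p) * γ₂ p * du ν₂ p < 0)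
    (codazzi₁ : ∀ p ∈ D,
      du (fun q => Real.log |dv ν₁ q / γ₁ q|) p = du ν₁ p / (ν₁ p - ν₂ p))
    (codazzi₂ : ∀ p ∈ D,
      dv (fun q => Real.log |du ν₂ q / γ₂ q|) p = -(dv ν₂ p / (ν₁ p - ν₂ p)))
    (gauss : ∀ p ∈ D,
      (ν₁ p - ν₂ p) / 2 * (du (fun q => γ₂ q ^ 2) p / du ν₂ p
        + dv (fun q => γ₁ q ^ 2) p / dv ν₁ p) - (γ₁ p ^ 2 - γ₂ p ^ 2) = ν₁ p * ν₂ p)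
    (z₀ X₀ Y₀ l₀ : Fin 3 → ℝ) (hframe : IsPosOrthonormalFrame X₀ Y₀ l₀) :
    (∃ D₀ : Set (ℝ × ℝ), IsOpen D₀ ∧ IsConnected D₀ ∧ (u₀, v₀) ∈ D₀ ∧ D₀ ⊆ D ∧
      ∃ z : ℝ × ℝ → (Fin 3 → ℝ), ContDiffOn ℝ ((n : WithTop ℕ∞) + 1) z D₀ ∧
        IsSolution ν₁ ν₂ γ₁ γ₂ (u₀, v₀) z₀ X₀ Y₀ l₀ z D₀) ∧
    (∀ D₁ : Set (ℝ × ℝ), IsOpen D₁ → IsConnected D₁ → (u₀, v₀) ∈ D₁ → D₁ ⊆ D →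
      ∀ z z' : ℝ × ℝ → (Fin 3 → ℝ),
        IsSolution ν₁ ν₂ γ₁ γ₂ (u₀, v₀) z₀ X₀ Y₀ l₀ z D₁ →
        IsSolution ν₁ ν₂ γ₁ γ₂ (u₀, v₀) z₀ X₀ Y₀ l₀ z' D₁ →
        Set.EqOn z z' D₁) := by
  have h1n : (1 : WithTop ℕ∞) ≤ n := by exact_mod_cast hn
  have hle : (n : WithTop ℕ∞) ≤ n + 1 := le_self_add
  have hν₁n := hν₁.of_le hle
  have hν₂n := hν₂.of_le hle
  have hν : ∀ p ∈ D, ν₁ p - ν₂ p ≠ 0 := fun p hp h => by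
    have := sign₁ p hp
    simp [h] at this
  have hg₁ : ∀ p ∈ D, γ₁ p ≠ 0 := fun p hp h => by
    have := sign₁ p hp
    simp [h] at this
  have hg₂ : ∀ p ∈ D, γ₂ p ≠ 0 := fun p hp h => by
    have := sign₂ p hp
    simp [h] at this
  have hd₁ : ∀ p ∈ D, dv ν₁ p ≠ 0 := fun p hp h => by
    have := sign₁ p hp
    simp [h] at this
  have hd₂ : ∀ p ∈ D, du ν₂ p ≠ 0 := fun p hp h => by
    have := sign₂ p hp
    simp [h] at this
  refine ⟨?_, fun D₁ hD₁ hD₁c hp₁ hD₁D z z' h h' =>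
    IsSolution.eqOn hD₁ hD₁c.isPreconnected hp₁ ((hν₁n.of_le h1n).mono hD₁D)
      ((hν₂n.of_le h1n).mono hD₁D) (hγ₁.continuousOn.mono hD₁D) (hγ₂.continuousOn.mono hD₁D) h h'⟩
  set f : ℝ × ℝ → ℝ := fun q => dv ν₁ q / γ₁ q with hf
  set g : ℝ × ℝ → ℝ := fun q => du ν₂ q / γ₂ q with hg
  have hfc : ContDiffOn ℝ n f D := (contDiffOn_dv hD hν₁).div hγ₁ hg₁
  have hgc : ContDiffOn ℝ n g D := (contDiffOn_du hD hν₂).div hγ₂ hg₂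
  -- These are the values of `√(-E)` and `√G` forced by the Codazzi equations. They involve first
  -- derivatives of `ν₁`, `ν₂`, hence only class `C^n`.
  have hac : ContDiffOn ℝ n (fun q => -g q / (ν₁ q - ν₂ q)) D := hgc.neg.div (hν₁n.sub hν₂n) hν
  have hbc : ContDiffOn ℝ n (fun q => -f q / (ν₁ q - ν₂ q)) D := hfc.neg.div (hν₁n.sub hν₂n) hν
  have diff : ∀ {f : ℝ × ℝ → ℝ}, ContDiffOn ℝ n f D → ∀ p ∈ D,
      HasFDerivAt f (partials (du f p) (dv f p)) p := fun hf p hp =>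
    hasFDerivAt_partials (((hf.of_le h1n).differentiableOn
      (by norm_num)).differentiableAt (hD.mem_nhds hp))
  have hdν : ∀ p ∈ D, HasFDerivAt (fun q => ν₁ q - ν₂ q)
      (partials (du ν₁ p) (dv ν₁ p) - partials (du ν₂ p) (dv ν₂ p)) p := fun p hp =>
    (diff hν₁n p hp).sub (diff hν₂n p hp)
  have hfu : ∀ p ∈ D, du f p = du ν₁ p / (ν₁ p - ν₂ p) * f p := fun p hp =>
    fderiv_eq_of_fderiv_log_abs (diff hfc p hp).differentiableAt
      (div_ne_zero (hd₁ p hp) (hg₁ p hp)) (codazzi₁ p hp)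
  have hgv : ∀ p ∈ D, dv g p = -(dv ν₂ p / (ν₁ p - ν₂ p)) * g p := fun p hp =>
    fderiv_eq_of_fderiv_log_abs (diff hgc p hp).differentiableAt
      (div_ne_zero (hd₂ p hp) (hg₂ p hp)) (codazzi₂ p hp)
  refine exists_isSolution hn hD h₀ hν₁n hν₂n hγ₁ hγ₂ hac hbc
    (fun p hp => mul_ne_zero (mul_ne_zero (hν p hp) (hg₁ p hp)) (hg₂ p hp))
    (fun p hp => ?_) (fun p hp => ?_) (fun p hp => ?_) (fun p hp => ?_) (fun p hp => ?_)
    (fun p hp => ?_) (fun p hp => ?_) z₀ hframe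
  · have := hν p hp
    have := hg₂ p hp
    -- Expanding the fraction makes the denominator a square and the numerator minus the quantity in
    -- condition 1.
    rw [show -g p / (ν₁ p - ν₂ p)
      = -((ν₁ p - ν₂ p) * γ₂ p * du ν₂ p) / ((ν₁ p - ν₂ p) * γ₂ p) ^ 2 by
        simp only [hg]; field_simp]
    exact div_pos (neg_pos.2 (sign₂ p hp)) (by positivity)
  · have := hν p hp
    have := hg₁ p hp
    rw [show -f p / (ν₁ p - ν₂ p)
      = -((ν₁ p - ν₂ p) * γ₁ p * dv ν₁ p) / ((ν₁ p - ν₂ p) * γ₁ p) ^ 2 by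
        simp only [hf]; field_simp]
    exact div_pos (neg_pos.2 (sign₁ p hp)) (by positivity)
  -- Quotient rule: by 2.1 the term with `g_v` cancels the one with `(ν₂)_v`, leaving `g (ν₁)_v /
  -- (ν₁-ν₂)² = γ₁ab`. The next case is symmetric.
  · have h1 : dv (fun q => -g q / (ν₁ q - ν₂ q)) p = _ := fderiv_neg_div (h := (0, 1))
      (diff hgc p hp).differentiableAt (hdν p hp).differentiableAt (hν p hp)
    have h2 : fderiv ℝ (fun q => ν₁ q - ν₂ q) p (0, 1) = dv ν₁ p - dv ν₂ p := by
      simp [(hdν p hp).fderiv]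
    have h3 : fderiv ℝ g p (0, 1) = _ := hgv p hp
    have := hν p hp
    have := hg₁ p hp
    rw [h1, h2, h3]
    simp only [hf]
    field_simp
    ring
  · have h1 : du (fun q => -f q / (ν₁ q - ν₂ q)) p = _ := fderiv_neg_div (h := (1, 0))
      (diff hfc p hp).differentiableAt (hdν p hp).differentiableAt (hν p hp)
    have h2 : fderiv ℝ (fun q => ν₁ q - ν₂ q) p (1, 0) = du ν₁ p - du ν₂ p := by
      simp [(hdν p hp).fderiv]
    have h3 : fderiv ℝ f p (1, 0) = _ := hfu p hp
    have := hν p hp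
    have := hg₂ p hp
    rw [h1, h2, h3]
    simp only [hg]
    field_simp
    ring
  · have := hν p hp
    have := hg₁ p hp
    simp only [hf]
    field_simp
  · have := hν p hp
    have := hg₂ p hp
    simp only [hg]
    field_simp
  -- Substituting the Codazzi equations into 2.2 gives `-(γ₂)_u/a - (γ₁)_v/b - (γ₁²-γ₂²) = ν₁ν₂`,
  -- which is the Gauss equation divided by `-ab`.
  · have h1 : dv (fun q => γ₁ q ^ 2) p = 2 * γ₁ p * dv γ₁ p := by
      simp only [pow_two]
      rw [dv_eq_of_hasFDerivAt (hasFDerivAt_mul_partials (diff hγ₁ p hp) (diff hγ₁ p hp))]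
      ring
    have h2 : du (fun q => γ₂ q ^ 2) p = 2 * γ₂ p * du γ₂ p := by
      simp only [pow_two]
      rw [du_eq_of_hasFDerivAt (hasFDerivAt_mul_partials (diff hγ₂ p hp) (diff hγ₂ p hp))]
      ring
    have h3 := gauss p hp
    rw [h1, h2] at h3
    have := hν p hp
    have := hg₁ p hp
    have := hg₂ p hp
    have := hd₁ p hp
    have := hd₂ p hp
    simp only [hf, hg]
    field_simp at h3 ⊢
    linear_combination -h3
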